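/- Let $n\ge 0$ and let $V,W$ be finite-dimensional complex inner product spaces, each equipped with a complex conjugation, that is, a conjugate-linear isometric involution $v\mapsto\bar v$ (equivalently, $V=\mathbb{C}\otimes_{\mathbb R}V'$ for a real inner product space $V'$; for instance $V=\mathbb{C}\otimes V'$ with $V'\subset\mathbb{R}^\infty$ finite-dimensional). Equip $\mathbb{C}^{n+1}$ with its standard inner product and coordinatewise conjugation. For complex inner product spaces $A,B$ of finite dimension let $\mathcal{J}^{\mathbf R}(A,B)$ be the space of complex linear isometries $A\to B$ with its topology as a subspace of $\mathrm{Hom}_{\mathbb C}(A,B)$. The group $C_2=\{1,g\}$ acts on $\mathcal{J}^{\mathbf R}(V,W)$ by $(g\cdot f)(v)=\overline{f(\bar v)}$. Let $$S\gamma^{\mathbf R}_{n+1}(V,W)=\{(f,x) : f\in\mathcal{J}^{\mathbf R}(V,W),\ x\in\mathbb{C}^{n+1}\otimes f(V)^{\perp},\ \|x\|=1\}\subset \mathcal{J}^{\mathbf R}(V,W)\times(\mathbb{C}^{n+1}\otimes W)$$ be the unit sphere bundle of the $(n+1)$-st complement bundle, with the diagonal action $g\cdot(f,x)=(g\cdot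 f,\bar x)$, where $\overline{c\otimes w}=\bar c\otimes\bar w$. Let $P$ be the poset of all nonzero complex subspaces $U\subseteq\mathbb{C}^{n+1}$ ordered by inclusion and topologised as the disjoint union of the Grassmannians, and consider the contravariant diagram $U\mapsto\mathcal{J}^{\mathbf R}(U\oplus V,W)$ on $P$, with maps given by restriction ($U\oplus V$ is the orthogonal sum). Its homotopy colimit $$\operatorname*{hocolim}_{0\ne U\subseteq\mathbb{C}^{n+1}}\mathcal{J}^{\mathbf R}(U\oplus V,W)$$ is taken over $P$ as a category object in spaces: it is the geometric realisation of the simplicial space whose $k$-simplices are the pairs $(G,z)$ of a chain $G(0)\supseteq G(1)\supseteq\dots\supseteq G(k)$ in $P$ and an isometry $z\in\mathcal{J}^{\mathbf R}(G(0)\oplus V,W)$, the space of pairs $(U,z)$ being topologised as the bundle of Stiefel manifolds over the Grassmannians; a monotone map $\theta$ acts by $(G,z)\mapsto(G\circ\theta, z|_{G(\theta(0))\oplus V})$. The group $C_2$ acts on it by $g\cdot[G,z,p]=[\overline{G},\,g\cdot z,\,p]$, where $\overline{G}(r)=\overline{G(r)}$, $(g\cdot z)(u,v)=\overline{z(\bar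 u,\bar v)}$ on $\overline{G(0)}\oplus V$, and $p\in\Delta^k$. Then there is a $C_2$-equivariant homeomorphism $$S\gamma^{\mathbf R}_{n+1}(V,W)\;\cong\;\operatorname*{hocolim}_{0\ne U\subseteq\mathbb{C}^{n+1}}\mathcal{J}^{\mathbf R}(U\oplus V,W).$$ -/

import Mathlib

open scoped TensorProduct

noncomputable section

namespace CalculusWithReality

/-! ### The group of order two and involutions -/

/-- The group with two elements. -/
abbrev C₂ : Type := Multiplicative (ZMod 2)

/-- The action of `C₂` on `X` whose non-identity element acts by the involution `τ`. -/
abbrev involutionAction {X : Type*} (τ : X → X) (hτ : Function.Involutive τ) :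
    MulAction C₂ X where
  smul g x := if g = 1 then x else τ x
  one_smul x := if_pos rfl
  mul_smul g h x := by
    change (if g * h = 1 then x else τ x) =
      if g = 1 then (if h = 1 then x else τ x) else τ (if h = 1 then x else τ x)
    have key : ∀ g h : C₂, g ≠ 1 → h ≠ 1 → g * h = 1 := by decide
    by_cases hg : g = 1
    · simp [hg]
    · by_cases hh : h = 1
      · simp [hg, hh]
      · simp [hg, hh, key g h hg hh, hτ x]

/-! ### Complex inner product spaces with a complex conjugation -/

/-- A complex conjugation on a complex inner product space: a conjugate-linear isometric
involution `v ↦ v̄`. In finite dimensions this is the same as writing the space as `ℂ ⊗ V'` for the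
real inner product space `V'` of fixed vectors, i.e. as having a basis of real vectors. -/
class RealStructure (V : Type*) [NormedAddCommGroup V] [InnerProductSpace ℂ V] where
  /-- complex conjugation -/
  conj : V ≃ₗᵢ⋆[ℂ] V
  conj_conj : ∀ v : V, conj (conj v) = v

/-- Complex conjugation. -/
abbrev conj {V : Type*} [NormedAddCommGroup V] [InnerProductSpace ℂ V] [RealStructure V] :
    V ≃ₗᵢ⋆[ℂ] V := RealStructure.conj

@[simp] theorem conj_conj {V : Type*} [NormedAddCommGroup V] [InnerProductSpace ℂ V]
    [RealStructure V] (v : V) : conj (conj v) = v := RealStructure.conj_conj v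

theorem inner_conj_conj {V : Type*} [NormedAddCommGroup V] [InnerProductSpace ℂ V]
    [RealStructure V] (v w : V) : inner ℂ (conj v) (conj w) = inner ℂ w v := by
  have h1 : ∀ a b : V, (inner ℂ (conj a) (conj b)).re = (inner ℂ a b).re := by
    intro a b
    have ha := norm_add_sq (𝕜 := ℂ) (conj a) (conj b)
    rw [← map_add, LinearIsometryEquiv.norm_map, LinearIsometryEquiv.norm_map,
      LinearIsometryEquiv.norm_map, norm_add_sq (𝕜 := ℂ) a b] at ha
    simp only [RCLike.re_to_complex] at ha
    linarith
  apply Complex.ext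
  · rw [h1, ← inner_conj_symm, Complex.conj_re]
  · have h2 := h1 (Complex.I • v) w
    rw [LinearIsometryEquiv.map_smulₛₗ, inner_smul_left, inner_smul_left] at h2
    rw [← inner_conj_symm w v, Complex.conj_im]
    simp at h2
    linarith

/-- The standard complex conjugation on `ℂᵐ`, coordinate by coordinate. -/
instance euclideanRealStructure (m : ℕ) : RealStructure (EuclideanSpace ℂ (Fin m)) where
  conj :=
    { toFun := fun v => WithLp.toLp 2 fun i => starRingEnd ℂ (v i)
      invFun := fun v => WithLp.toLp 2 fun i => starRingEnd ℂ (v i)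
      map_add' := fun v w => by ext i; simp
      map_smul' := fun c v => by ext i; simp
      left_inv := fun v => by ext i; simp
      right_inv := fun v => by ext i; simp
      norm_map' := fun v => by simp [EuclideanSpace.norm_eq] }
  conj_conj v := by
    ext i
    change starRingEnd ℂ (starRingEnd ℂ (v i)) = v i
    simp

/-! ### Spaces of linear isometries -/

section Isometries

variable {V W : Type*} [NormedAddCommGroup V] [InnerProductSpace ℂ V]
  [NormedAddCommGroup W] [InnerProductSpace ℂ W]

/-- The Stiefel topology on the set of complex linear isometries `V → W`. -/
instance isometryTopology : TopologicalSpace (V →ₗᵢ[ℂ] W) :=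
  TopologicalSpace.induced LinearIsometry.toContinuousLinearMap inferInstance

variable [RealStructure V] [RealStructure W]

/-- The action of the non-identity element of `C₂` on isometries: `(g f)(v) = conj (f (conj v))`. -/
def conjIsometry (f : V →ₗᵢ[ℂ] W) : V →ₗᵢ[ℂ] W :=
  (conj (V := W)).toLinearIsometry.comp (f.comp (conj (V := V)).toLinearIsometry)

@[simp] theorem conjIsometry_apply (f : V →ₗᵢ[ℂ] W) (v : V) :
    conjIsometry f v = conj (f (conj v)) := rfl

theorem conjIsometry_conjIsometry (f : V →ₗᵢ[ℂ] W) : conjIsometry (conjIsometry f) = f := by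
  ext v; simp

/-- Complex conjugation on `V ⊗ W`, with `conj (v ⊗ w) = conj v ⊗ conj w`. -/
def conjTensor : V ⊗[ℂ] W →ₛₗ[starRingEnd ℂ] V ⊗[ℂ] W :=
  TensorProduct.map (conj (V := V)).toLinearEquiv.toLinearMap
    (conj (V := W)).toLinearEquiv.toLinearMap

@[simp] theorem conjTensor_tmul (v : V) (w : W) :
    conjTensor (v ⊗ₜ[ℂ] w) = conj v ⊗ₜ[ℂ] conj w := rfl

theorem conjTensor_conjTensor (x : V ⊗[ℂ] W) : conjTensor (conjTensor x) = x := by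
  induction x with
  | zero => simp
  | tmul v w => simp
  | add x y hx hy => rw [map_add, map_add, hx, hy]

theorem inner_conjTensor (x y : V ⊗[ℂ] W) :
    inner ℂ (conjTensor x) (conjTensor y) = inner ℂ y x := by
  induction x with
  | zero => simp
  | add a b ha hb => rw [map_add, inner_add_left, ha, hb, inner_add_right]
  | tmul v w =>
    induction y with
    | zero => simp
    | add a b ha hb => rw [map_add, inner_add_right, ha, hb, inner_add_left]
    | tmul v' w' => simp [inner_conj_conj]

theorem norm_conjTensor (x : V ⊗[ℂ] W) : ‖conjTensor x‖ = ‖x‖ := by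
  rw [@norm_eq_sqrt_re_inner ℂ, inner_conjTensor]
  exact (norm_eq_sqrt_re_inner (𝕜 := ℂ) x).symm

end Isometries

/-! ### The complement bundles and their sphere bundles -/

section Bundle

variable (m : ℕ) (V W : Type*) [NormedAddCommGroup V] [InnerProductSpace ℂ V]
  [NormedAddCommGroup W] [InnerProductSpace ℂ W]

variable {V W} in
/-- The fibre `ℂᵐ ⊗ f(V)ᗮ` of the `m`-th complement bundle at `f`, as a subspace of `ℂᵐ ⊗ W`. -/
def complementFibre (f : V →ₗᵢ[ℂ] W) : Submodule ℂ (EuclideanSpace ℂ (Fin m) ⊗[ℂ] W) :=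
  LinearMap.range
    (LinearMap.lTensor (EuclideanSpace ℂ (Fin m)) (LinearMap.range f.toLinearMap)ᗮ.subtype)

/-- The total space `γ_m(V, W)` of the `m`-th complement bundle: pairs `(f, x)` with
`x ∈ ℂᵐ ⊗ f(V)ᗮ`, topologised as a subspace of the product with `ℂᵐ ⊗ W`. -/
abbrev ComplementBundle : Type _ :=
  {y : (V →ₗᵢ[ℂ] W) × (EuclideanSpace ℂ (Fin m) ⊗[ℂ] W) // y.2 ∈ complementFibre m y.1}

/-- The sphere bundle `Sγ_m(V, W)`: the unit vectors in the complement bundle. -/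
def SphereBundle : Type _ := {y : ComplementBundle m V W // ‖y.1.2‖ = 1}

instance : TopologicalSpace (SphereBundle m V W) :=
  inferInstanceAs (TopologicalSpace {y : ComplementBundle m V W // ‖y.1.2‖ = 1})

variable {V W}
variable [RealStructure V] [RealStructure W]

theorem conj_mem_orthogonal (f : V →ₗᵢ[ℂ] W) {w : W}
    (hw : w ∈ (LinearMap.range f.toLinearMap)ᗮ) :
    conj w ∈ (LinearMap.range (conjIsometry f).toLinearMap)ᗮ := by
  rw [Submodule.mem_orthogonal] at hw ⊢
  rintro _ ⟨v, rfl⟩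
  change inner ℂ (conj (f (conj v))) (conj w) = 0
  rw [inner_conj_conj, ← inner_conj_symm]
  exact (congrArg _ (hw _ ⟨conj v, rfl⟩)).trans (map_zero _)

theorem conjTensor_mem (f : V →ₗᵢ[ℂ] W) {x : EuclideanSpace ℂ (Fin m) ⊗[ℂ] W}
    (hx : x ∈ complementFibre m f) : conjTensor x ∈ complementFibre m (conjIsometry f) := by
  obtain ⟨y, rfl⟩ := hx
  induction y with
  | zero => simp
  | add a b ha hb => rw [map_add, map_add]; exact add_mem ha hb
  | tmul e w =>
    exact ⟨conj e ⊗ₜ ⟨conj (w : W), conj_mem_orthogonal f w.2⟩, rfl⟩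

/-- The action of the non-identity element of `C₂` on the sphere bundle, induced from the diagonal
action: `(f, x) ↦ (g f, conj x)`. -/
def SphereBundle.conj (y : SphereBundle m V W) : SphereBundle m V W :=
  ⟨⟨(conjIsometry y.1.1.1, conjTensor y.1.1.2), conjTensor_mem m _ y.1.2⟩,
    (norm_conjTensor _).trans y.2⟩

theorem SphereBundle.conj_involutive :
    Function.Involutive (SphereBundle.conj m : SphereBundle m V W → SphereBundle m V W) :=
  fun _ => Subtype.ext (Subtype.ext
    (Prod.ext (conjIsometry_conjIsometry _) (conjTensor_conjTensor _)))

instance : MulAction C₂ (SphereBundle m V W) :=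
  involutionAction (SphereBundle.conj m) (SphereBundle.conj_involutive m)

end Bundle

/-! ### Homotopy colimits over topological posets -/

universe u v

/-- A contravariant diagram of spaces on a topological poset `P` (a poset regarded as a category
object in spaces): the space `Total` of pairs `(p, z)` with `z` in the value at `p`, its projection
to `P`, and the restriction maps for `q ≤ p`, which are functorial and jointly continuous. -/
structure TopDiagram (P : Type u) [TopologicalSpace P] [PartialOrder P] where
  Total : Type v
  [topology : TopologicalSpace Total]
  base : Total → P
  continuous_base : Continuous base
  restrict : (z : Total) → (q : P) → q ≤ base z → Total
  base_restrict : ∀ z q h, base (restrict z q h) = q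
  restrict_self : ∀ z, restrict z (base z) le_rfl = z
  restrict_restrict : ∀ z q h q' (h' : q' ≤ base (restrict z q h)),
    restrict (restrict z q h) q' h' = restrict z q' (h'.trans ((base_restrict z q h).trans_le h))
  continuous_restrict :
    Continuous fun x : {x : Total × P // x.2 ≤ base x.1} => restrict x.1.1 x.1.2 x.2

attribute [instance] TopDiagram.topology

namespace TopDiagram

variable {P : Type u} [TopologicalSpace P] [PartialOrder P] (D : TopDiagram.{u, v} P)

/-- The space of `k`-simplices of the simplicial replacement of `D`: chains `G 0 ≥ ⋯ ≥ G k`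
in `P` together with a point in the value of `D` at `G 0`. -/
abbrev Simplex (k : ℕ) : Type _ :=
  {s : (Fin (k + 1) → P) × D.Total // Antitone s.1 ∧ D.base s.2 = s.1 0}

variable {D} in
/-- The simplicial operator of a monotone map `θ : [k] → [l]`: precompose the chain with `θ` and
restrict the point from `G 0` to `G (θ 0)`. -/
def Simplex.pull {k l : ℕ} (θ : Fin (k + 1) →o Fin (l + 1)) (s : D.Simplex l) : D.Simplex k :=
  ⟨(s.1.1 ∘ θ, D.restrict s.1.2 (s.1.1 (θ 0)) ((s.2.1 (Fin.zero_le _)).trans_eq s.2.2.symm)),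
    s.2.1.comp_monotone θ.monotone, D.base_restrict _ _ _⟩

/-- The disjoint union over `k` of the products of the space of `k`-simplices with `Δᵏ`. -/
abbrev PreHocolim : Type _ := Σ k : ℕ, D.Simplex k × stdSimplex ℝ (Fin (k + 1))

/-- The identifications `(θ^* s, p) ∼ (s, θ_* p)` of geometric realisation. -/
inductive Glue : D.PreHocolim → D.PreHocolim → Prop
  | glue {k l : ℕ} (θ : Fin (k + 1) →o Fin (l + 1)) (s : D.Simplex l)
      (p : stdSimplex ℝ (Fin (k + 1))) :
      Glue ⟨k, (s.pull θ, p)⟩ ⟨l, (s, stdSimplex.map θ p)⟩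

/-- The homotopy colimit of `D`: the geometric realisation of its simplicial replacement, with the
quotient topology. -/
def Hocolim : Type _ := Quot D.Glue

instance : TopologicalSpace D.Hocolim := inferInstanceAs (TopologicalSpace (Quot D.Glue))

/-- An involution of the diagram: compatible continuous involutions of the topological poset and
of the total space. -/
structure Involution where
  onBase : P → P
  onTotal : D.Total → D.Total
  continuous_onBase : Continuous onBase
  continuous_onTotal : Continuous onTotal
  monotone_onBase : Monotone onBase
  involutive_onBase : Function.Involutive onBase
  involutive_onTotal : Function.Involutive onTotal
  base_onTotal : ∀ z, D.base (onTotal z) = onBase (D.base z)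
  onTotal_restrict : ∀ z q h, onTotal (D.restrict z q h) =
    D.restrict (onTotal z) (onBase q) ((monotone_onBase h).trans_eq (base_onTotal z).symm)

variable {D} (τ : D.Involution)

/-- The induced map on `k`-simplices. -/
def Involution.onSimplex {k : ℕ} (s : D.Simplex k) : D.Simplex k :=
  ⟨(τ.onBase ∘ s.1.1, τ.onTotal s.1.2), τ.monotone_onBase.comp_antitone s.2.1,
    (τ.base_onTotal _).trans (congrArg τ.onBase s.2.2)⟩

theorem Involution.onSimplex_pull {k l : ℕ} (θ : Fin (k + 1) →o Fin (l + 1)) (s : D.Simplex l) :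
    τ.onSimplex (s.pull θ) = (τ.onSimplex s).pull θ :=
  Subtype.ext (Prod.ext rfl (τ.onTotal_restrict _ _ _))

theorem Involution.onSimplex_onSimplex {k : ℕ} (s : D.Simplex k) :
    τ.onSimplex (τ.onSimplex s) = s :=
  Subtype.ext (Prod.ext (funext fun _ => τ.involutive_onBase _) (τ.involutive_onTotal _))

/-- The induced map on the homotopy colimit, `[G, z, p] ↦ [τ G, τ z, p]`. -/
def Involution.onHocolim : D.Hocolim → D.Hocolim :=
  Quot.map (fun x => ⟨x.1, (τ.onSimplex x.2.1, x.2.2)⟩) (by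
    rintro _ _ ⟨θ, s, p⟩
    rw [τ.onSimplex_pull]
    exact Glue.glue θ (τ.onSimplex s) p)

theorem Involution.onHocolim_involutive : Function.Involutive τ.onHocolim := by
  rintro ⟨k, s, p⟩
  change Quot.mk D.Glue ⟨k, (τ.onSimplex (τ.onSimplex s), p)⟩ = Quot.mk D.Glue ⟨k, (s, p)⟩
  rw [τ.onSimplex_onSimplex]

end TopDiagram

/-! ### The diagram `U ↦ J(U ⊕ V, W)` on the nonzero subspaces of `ℂᵐ` -/

/-- The poset of nonzero complex subspaces of `ℂᵐ`, ordered by inclusion. -/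
abbrev NonzeroSubspace (m : ℕ) : Type :=
  {U : Submodule ℂ (EuclideanSpace ℂ (Fin m)) // U ≠ ⊥}

/-- The topology of the disjoint union of the Grassmannians: a subspace is identified with the
orthogonal projection onto it. -/
instance grassmannTopology (m : ℕ) : TopologicalSpace (NonzeroSubspace m) :=
  TopologicalSpace.induced (fun U => U.1.starProjection) inferInstance

/-- Complex conjugation of subspaces, `U ↦ {conj u | u ∈ U} = {u | conj u ∈ U}`. -/
def NonzeroSubspace.conj {m : ℕ} (U : NonzeroSubspace m) : NonzeroSubspace m :=
  ⟨U.1.comap (CalculusWithReality.conj (V := EuclideanSpace ℂ (Fin m))).toLinearEquiv.toLinearMap,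
    by
      obtain ⟨u, hu, hu0⟩ := (Submodule.ne_bot_iff _).1 U.2
      refine (Submodule.ne_bot_iff _).2 ⟨CalculusWithReality.conj u, ?_, ?_⟩
      · change CalculusWithReality.conj (CalculusWithReality.conj u) ∈ U.1
        rwa [conj_conj]
      · simpa using hu0⟩

theorem NonzeroSubspace.mem_conj {m : ℕ} (U : NonzeroSubspace m) (u : EuclideanSpace ℂ (Fin m)) :
    u ∈ U.conj.1 ↔ CalculusWithReality.conj u ∈ U.1 := Iff.rfl

theorem NonzeroSubspace.conj_involutive {m : ℕ} :
    Function.Involutive (NonzeroSubspace.conj (m := m)) := by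
  intro U
  ext u
  simp [NonzeroSubspace.mem_conj]

section Stiefel

variable (m : ℕ) (V W : Type*) [NormedAddCommGroup V] [InnerProductSpace ℂ V]
  [NormedAddCommGroup W] [InnerProductSpace ℂ W]

/-- Pairs of a nonzero subspace `U` of `ℂᵐ` and a linear isometry `U ⊕ V → W`, where `U ⊕ V`
is the orthogonal direct sum. -/
structure StiefelTotal where
  dom : NonzeroSubspace m
  iso : WithLp 2 (dom.1 × V) →ₗᵢ[ℂ] W

variable {m V W}

/-- The linear map `ℂᵐ ⊕ V → W` that extends an isometry on `U ⊕ V` by zero on `Uᗮ`. -/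
def StiefelTotal.extend (z : StiefelTotal m V W) :
    WithLp 2 (EuclideanSpace ℂ (Fin m) × V) →L[ℂ] W :=
  z.iso.toContinuousLinearMap ∘L
    (WithLp.prodContinuousLinearEquiv 2 ℂ z.dom.1 V).symm.toContinuousLinearMap ∘L
    (z.dom.1.orthogonalProjectionOnto.prodMap (ContinuousLinearMap.id ℂ V)) ∘L
    (WithLp.prodContinuousLinearEquiv 2 ℂ (EuclideanSpace ℂ (Fin m)) V).toContinuousLinearMap

/-- The topology of the bundle over the Grassmannians with fibre the Stiefel manifold of isometries
`U ⊕ V → W` at `U`: isometries on nearby subspaces are compared after extension by zero. -/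
instance : TopologicalSpace (StiefelTotal m V W) :=
  TopologicalSpace.induced (fun z => (z.dom, z.extend)) inferInstance

theorem StiefelTotal.extend_apply (z : StiefelTotal m V W) (u : EuclideanSpace ℂ (Fin m)) (v : V) :
    z.extend (WithLp.toLp 2 (u, v)) =
      z.iso (WithLp.toLp 2 (z.dom.1.orthogonalProjectionOnto u, v)) := rfl

theorem StiefelTotal.extend_coe (z : StiefelTotal m V W) (u : z.dom.1) (v : V) :
    z.extend (WithLp.toLp 2 ((u : EuclideanSpace ℂ (Fin m)), v)) = z.iso (WithLp.toLp 2 (u, v)) := by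
  rw [extend_apply]; simp

theorem StiefelTotal.ext_of {z z' : StiefelTotal m V W} (h : z.dom = z'.dom)
    (h' : ∀ (u : EuclideanSpace ℂ (Fin m)) (hu : u ∈ z.dom.1) (hu' : u ∈ z'.dom.1) (v : V),
      z.iso (WithLp.toLp 2 (⟨u, hu⟩, v)) = z'.iso (WithLp.toLp 2 (⟨u, hu'⟩, v))) : z = z' := by
  obtain ⟨U, f⟩ := z
  obtain ⟨U', f'⟩ := z'
  obtain rfl : U = U' := h
  congr 1
  ext ⟨⟨u, hu⟩, v⟩
  exact h' u hu hu v

/-- The inclusion `U' ⊕ V → U ⊕ V` for `U' ≤ U`. -/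
def sumInclusion {E : Type*} [NormedAddCommGroup E] [InnerProductSpace ℂ E]
    {U' U : Submodule ℂ E} (h : U' ≤ U) : WithLp 2 (U' × V) →ₗᵢ[ℂ] WithLp 2 (U × V) where
  toFun x := WithLp.toLp 2 (Submodule.inclusion h x.fst, x.snd)
  map_add' x y := rfl
  map_smul' c x := rfl
  norm_map' x := by
    rw [← sq_eq_sq₀ (norm_nonneg _) (norm_nonneg _), WithLp.prod_norm_sq_eq_of_L2,
      WithLp.prod_norm_sq_eq_of_L2]
    rfl

/-- Restriction of an isometry on `U ⊕ V` to `U' ⊕ V`. -/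
def StiefelTotal.restrict (z : StiefelTotal m V W) (U' : NonzeroSubspace m) (h : U' ≤ z.dom) :
    StiefelTotal m V W :=
  ⟨U', z.iso.comp (sumInclusion h)⟩

theorem StiefelTotal.extend_restrict (z : StiefelTotal m V W) (U' : NonzeroSubspace m)
    (h : U' ≤ z.dom) (x : WithLp 2 (EuclideanSpace ℂ (Fin m) × V)) :
    (z.restrict U' h).extend x = z.extend (WithLp.toLp 2 (U'.1.starProjection x.fst, x.snd)) :=
  (StiefelTotal.extend_coe z
    (Submodule.inclusion h (U'.1.orthogonalProjectionOnto x.fst)) x.snd).symm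

theorem StiefelTotal.continuous_dom :
    Continuous (StiefelTotal.dom : StiefelTotal m V W → NonzeroSubspace m) :=
  continuous_fst.comp (continuous_induced_dom (f := fun z : StiefelTotal m V W => (z.dom, z.extend)))

theorem StiefelTotal.continuous_extend :
    Continuous (StiefelTotal.extend : StiefelTotal m V W → _) :=
  continuous_snd.comp (continuous_induced_dom (f := fun z : StiefelTotal m V W => (z.dom, z.extend)))

theorem StiefelTotal.continuous_restrict :
    Continuous fun x : {x : StiefelTotal m V W × NonzeroSubspace m // x.2 ≤ x.1.dom} =>
      x.1.1.restrict x.1.2 x.2 := by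
  refine continuous_induced_rng.2 (Continuous.prodMk ?_ ?_)
  · exact continuous_snd.comp continuous_subtype_val
  · have h : ∀ x : {x : StiefelTotal m V W × NonzeroSubspace m // x.2 ≤ x.1.dom},
        (x.1.1.restrict x.1.2 x.2).extend = x.1.1.extend ∘L
          (WithLp.prodContinuousLinearEquiv 2 ℂ
            (EuclideanSpace ℂ (Fin m)) V).symm.toContinuousLinearMap ∘L
          (x.1.2.1.starProjection.prodMap (ContinuousLinearMap.id ℂ V)) ∘L
          (WithLp.prodContinuousLinearEquiv 2 ℂ
            (EuclideanSpace ℂ (Fin m)) V).toContinuousLinearMap := by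
      intro x
      ext y
      exact StiefelTotal.extend_restrict _ _ _ _
    change Continuous fun x : {x : StiefelTotal m V W × NonzeroSubspace m // x.2 ≤ x.1.dom} =>
      (x.1.1.restrict x.1.2 x.2).extend
    simp only [h]
    have h1 : Continuous fun x : {x : StiefelTotal m V W × NonzeroSubspace m // x.2 ≤ x.1.dom} =>
        x.1.1.extend :=
      StiefelTotal.continuous_extend.comp (continuous_fst.comp continuous_subtype_val)
    have h2 : Continuous fun x : {x : StiefelTotal m V W × NonzeroSubspace m // x.2 ≤ x.1.dom} =>
        x.1.2.1.starProjection :=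
      (continuous_induced_dom (f := fun U : NonzeroSubspace m => U.1.starProjection)).comp
        (continuous_snd.comp continuous_subtype_val)
    exact h1.clm_comp (continuous_const.clm_comp
      ((h2.prod_mapL ℂ continuous_const).clm_comp continuous_const))

variable (m V W) in
/-- The contravariant diagram `U ↦ J(U ⊕ V, W)` on the topological poset of nonzero subspaces
of `ℂᵐ`. -/
def stiefelDiagram : TopDiagram (NonzeroSubspace m) where
  Total := StiefelTotal m V W
  base := StiefelTotal.dom
  continuous_base := StiefelTotal.continuous_dom
  restrict := StiefelTotal.restrict
  base_restrict _ _ _ := rfl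
  restrict_self _ := rfl
  restrict_restrict _ _ _ _ _ := rfl
  continuous_restrict := StiefelTotal.continuous_restrict

variable [RealStructure V] [RealStructure W]

/-- The map `φ ⊕ conj : A ⊕ V → B ⊕ V`, for a conjugate-linear isometry `φ : A → B`. -/
def sumConj {A B : Type*} [NormedAddCommGroup A] [InnerProductSpace ℂ A]
    [NormedAddCommGroup B] [InnerProductSpace ℂ B] (φ : A →ₛₗᵢ[starRingEnd ℂ] B) :
    WithLp 2 (A × V) →ₛₗᵢ[starRingEnd ℂ] WithLp 2 (B × V) where
  toFun x := WithLp.toLp 2 (φ x.fst, conj x.snd)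
  map_add' x y := by
    simp [← WithLp.toLp_add]
  map_smul' c x := by
    simp [← WithLp.toLp_smul, LinearIsometry.map_smulₛₗ, LinearIsometryEquiv.map_smulₛₗ]
  norm_map' x := by
    rw [← sq_eq_sq₀ (norm_nonneg _) (norm_nonneg _), WithLp.prod_norm_sq_eq_of_L2,
      WithLp.prod_norm_sq_eq_of_L2, ← φ.norm_map x.fst, ← (conj (V := V)).norm_map x.snd]
    rfl

/-- Complex conjugation `Ū → U`. -/
def NonzeroSubspace.conjMap (U : NonzeroSubspace m) : U.conj.1 →ₛₗᵢ[starRingEnd ℂ] U.1 where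
  toFun u := ⟨CalculusWithReality.conj (u : EuclideanSpace ℂ (Fin m)), u.2⟩
  map_add' _ _ := Subtype.ext (map_add _ _ _)
  map_smul' _ _ := Subtype.ext (LinearIsometryEquiv.map_smulₛₗ _ _ _)
  norm_map' u := LinearIsometryEquiv.norm_map CalculusWithReality.conj (u : EuclideanSpace ℂ (Fin m))

/-- The action of the non-identity element of `C₂`: it takes an isometry `z : U ⊕ V → W` to the
isometry `Ū ⊕ V → W` with `(u, v) ↦ conj (z (conj u, conj v))`. -/
def StiefelTotal.conj (z : StiefelTotal m V W) : StiefelTotal m V W where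
  dom := z.dom.conj
  iso := (CalculusWithReality.conj (V := W)).toLinearIsometry.comp
    (z.iso.comp (sumConj (A := z.dom.conj.1) (B := z.dom.1) (V := V) z.dom.conjMap))

theorem NonzeroSubspace.starProjection_conj (U : NonzeroSubspace m)
    (u : EuclideanSpace ℂ (Fin m)) : U.conj.1.starProjection u =
      CalculusWithReality.conj (U.1.starProjection (CalculusWithReality.conj u)) := by
  refine Submodule.eq_starProjection_of_mem_of_inner_eq_zero ?_ fun w hw => ?_
  · rw [NonzeroSubspace.mem_conj, conj_conj]
    exact Submodule.starProjection_apply_mem _ _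
  · rw [← conj_conj u, ← conj_conj w, conj_conj (CalculusWithReality.conj u), ← map_sub,
      inner_conj_conj, ← inner_conj_symm]
    rw [Submodule.starProjection_inner_eq_zero _ _ ((U.mem_conj w).1 hw), map_zero]

theorem NonzeroSubspace.continuous_conj :
    Continuous (NonzeroSubspace.conj : NonzeroSubspace m → NonzeroSubspace m) := by
  refine continuous_induced_rng.2 ?_
  have h : ∀ U : NonzeroSubspace m, U.conj.1.starProjection =
      (CalculusWithReality.conj (V := EuclideanSpace ℂ (Fin m))
        ).toLinearIsometry.toContinuousLinearMap.comp
        (U.1.starProjection.comp (CalculusWithReality.conj (V := EuclideanSpace ℂ (Fin m))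
          ).toLinearIsometry.toContinuousLinearMap) := by
    intro U
    ext1 u
    exact U.starProjection_conj u
  change Continuous fun U : NonzeroSubspace m => U.conj.1.starProjection
  simp only [h]
  have h2 : Continuous fun U : NonzeroSubspace m => U.1.starProjection :=
    continuous_induced_dom (f := fun U : NonzeroSubspace m => U.1.starProjection)
  exact (ContinuousLinearMap.postcomp _ _).continuous.comp
    ((ContinuousLinearMap.precomp _ _).continuous.comp h2)

theorem StiefelTotal.extend_conj (z : StiefelTotal m V W)
    (x : WithLp 2 (EuclideanSpace ℂ (Fin m) × V)) :
    z.conj.extend x = CalculusWithReality.conj (z.extend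
      (sumConj (CalculusWithReality.conj (V := EuclideanSpace ℂ (Fin m))).toLinearIsometry x)) := by
  have h : z.dom.conjMap (z.dom.conj.1.orthogonalProjectionOnto x.fst) =
      z.dom.1.orthogonalProjectionOnto (CalculusWithReality.conj x.fst) := by
    apply Subtype.ext
    change CalculusWithReality.conj (z.dom.conj.1.starProjection x.fst) =
      z.dom.1.starProjection (CalculusWithReality.conj x.fst)
    rw [NonzeroSubspace.starProjection_conj, conj_conj]
  change CalculusWithReality.conj (z.iso (WithLp.toLp 2
    (z.dom.conjMap (z.dom.conj.1.orthogonalProjectionOnto x.fst), CalculusWithReality.conj x.snd))) = _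
  rw [h]
  rfl

theorem StiefelTotal.continuous_conj :
    Continuous (StiefelTotal.conj : StiefelTotal m V W → StiefelTotal m V W) := by
  refine continuous_induced_rng.2 (Continuous.prodMk ?_ ?_)
  · exact NonzeroSubspace.continuous_conj.comp StiefelTotal.continuous_dom
  · have h : ∀ z : StiefelTotal m V W, z.conj.extend =
        (CalculusWithReality.conj (V := W)).toLinearIsometry.toContinuousLinearMap.comp
        (z.extend.comp (sumConj (V := V) (CalculusWithReality.conj
          (V := EuclideanSpace ℂ (Fin m))).toLinearIsometry).toContinuousLinearMap) := by
      intro z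
      ext1 x
      exact z.extend_conj x
    change Continuous fun z : StiefelTotal m V W => z.conj.extend
    simp only [h]
    exact (ContinuousLinearMap.postcomp _ _).continuous.comp
      ((ContinuousLinearMap.precomp _ _).continuous.comp StiefelTotal.continuous_extend)

theorem StiefelTotal.conj_involutive :
    Function.Involutive (StiefelTotal.conj : StiefelTotal m V W → StiefelTotal m V W) := by
  intro z
  refine StiefelTotal.ext_of (NonzeroSubspace.conj_involutive _) fun u hu hu' v => ?_
  have hu2 : CalculusWithReality.conj (CalculusWithReality.conj u) ∈ z.dom.1 := by
    rwa [conj_conj]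
  have hc : (⟨CalculusWithReality.conj (CalculusWithReality.conj u), hu2⟩ : z.dom.1) = ⟨u, hu'⟩ :=
    Subtype.ext (conj_conj u)
  change CalculusWithReality.conj (CalculusWithReality.conj (z.iso (WithLp.toLp 2
    (⟨CalculusWithReality.conj (CalculusWithReality.conj u), hu2⟩,
      CalculusWithReality.conj (CalculusWithReality.conj v))))) = _
  rw [hc, conj_conj, conj_conj]

variable (m V W) in
/-- The involution of the diagram `U ↦ J(U ⊕ V, W)` given by complex conjugation. -/
def stiefelInvolution : (stiefelDiagram m V W).Involution where
  onBase := NonzeroSubspace.conj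
  onTotal := StiefelTotal.conj
  continuous_onBase := NonzeroSubspace.continuous_conj
  continuous_onTotal := StiefelTotal.continuous_conj
  monotone_onBase := fun _ _ h => Submodule.comap_mono h
  involutive_onBase := NonzeroSubspace.conj_involutive
  involutive_onTotal := StiefelTotal.conj_involutive
  base_onTotal _ := rfl
  onTotal_restrict _ _ _ := rfl

variable (m V W) in
/-- The homotopy colimit of `J(U ⊕ V, W)` over the topological poset of nonzero subspaces `U`
of `ℂᵐ`. -/
abbrev StiefelHocolim : Type _ := (stiefelDiagram m V W).Hocolim

instance : MulAction C₂ (StiefelHocolim m V W) :=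
  involutionAction _ (stiefelInvolution m V W).onHocolim_involutive

end Stiefel

end CalculusWithReality

end

/-! By the standard basis, a point `(f, x)` of the sphere bundle is an isometry `f` together with a
nonzero linear map `T : ℂᵐ → f(V)ᗮ`, up to positive scaling. The polar decomposition writes `T = S
A` with `A` positive and `S` isometric on the range of `A`. By the spectral theorem `A = ∑ pᵢ
P_{Gᵢ}` for a unique strictly decreasing flag of nonzero subspaces starting at the range of `A`,
with unique weights `pᵢ > 0`: these are the gaps between successive eigenvalues
(`exists_eq_flagSum`, `flagSum_injective`). As `‖A‖ = ∑ pᵢ`, scaling `T` to operator norm one makes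
`p` an interior point of a simplex, while `S` and `f` combine to an isometry `G 0 ⊕ V → W`. This is
exactly a nondegenerate simplex of the homotopy colimit with an interior point of `Δᵏ`.

The comparison map goes the other way, `[G, z, p] ↦ (z|V, z ∘ ∑ pᵢ P_{Gᵢ})`, rescaled to a unit
tensor. The gluing relations hold because weights on equal subspaces add up and a subspace of weight
zero does not contribute. Surjectivity is existence of the two decompositions and injectivity is
their uniqueness, once every point has a nondegenerate representative. The inverse need not be shown
continuous by hand: finitely many compact simplex spaces cover the source, and the target is
Hausdorff. Equivariance holds since the standard basis and the weights are real. -/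

open scoped TensorProduct

noncomputable section

namespace CalculusWithReality

/-! ### Positive operators as weighted sums of projections onto flags -/

section FlagSum

variable {E : Type*} [NormedAddCommGroup E] [InnerProductSpace ℂ E] [FiniteDimensional ℂ E]

/-- A positive operator kills the isotropic vectors of its quadratic form. -/
theorem apply_eq_zero_of_re_inner_eq_zero {A : E →L[ℂ] E} (hA : A.IsPositive) {v : E}
    (hv : (inner ℂ (A v) v).re = 0) : A v = 0 := by
  have hA0 : 0 ≤ A := (ContinuousLinearMap.nonneg_iff_isPositive A).2 hA
  have hS := (ContinuousLinearMap.nonneg_iff_isPositive (CFC.sqrt A)).1 (CFC.sqrt_nonneg A)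
  have hSS : CFC.sqrt A * CFC.sqrt A = A := CFC.sqrt_mul_sqrt_self A
  have h (w : E) : A w = CFC.sqrt A (CFC.sqrt A w) := by
    conv_lhs => rw [← hSS]
    rfl
  rw [h v, hS.inner_left_eq_inner_right, ← RCLike.re_to_complex, inner_self_eq_norm_sq,
    sq_eq_zero_iff, norm_eq_zero] at hv
  rw [h v, hv, map_zero]

/-- Self-adjointness makes the kernel orthogonal to the range. -/
theorem eq_zero_of_mem_ker_of_mem_range {E : Type*} [NormedAddCommGroup E] [InnerProductSpace ℂ E]
    {A : E →L[ℂ] E} (hA : A.IsPositive) {v : E}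
    (hv : A v = 0) (hv' : v ∈ A.range) : v = 0 := by
  obtain ⟨w, rfl⟩ := hv'
  change A (A w) = 0 at hv
  change A w = 0
  rw [← inner_self_eq_zero (𝕜 := ℂ), hA.inner_left_eq_inner_right, hv, inner_zero_right]

theorem re_inner_starProjection_self (U : Submodule ℂ E) (v : E) :
    (inner ℂ (U.starProjection v) v).re = ‖U.starProjection v‖ ^ 2 :=
  U.re_inner_starProjection_eq_normSq v

/-- The operator `∑ pᵢ Pᵢ`, where `Pᵢ` is the orthogonal projection onto `G i`. -/
def flagSum {k : ℕ} (G : Fin k → Submodule ℂ E) (p : Fin k → ℝ) : E →L[ℂ] E :=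
  ∑ i, (p i : ℂ) • (G i).starProjection

theorem flagSum_apply {k : ℕ} (G : Fin k → Submodule ℂ E) (p : Fin k → ℝ) (u : E) :
    flagSum G p u = ∑ i, (p i : ℂ) • (G i).starProjection u := by
  simp [flagSum]

theorem flagSum_succ {k : ℕ} (G : Fin (k + 1) → Submodule ℂ E) (p : Fin (k + 1) → ℝ) :
    flagSum G p = (p 0 : ℂ) • (G 0).starProjection +
      flagSum (fun i => G i.succ) (fun i => p i.succ) := by
  simp [flagSum, Fin.sum_univ_succ]

theorem flagSum_isPositive {k : ℕ} (G : Fin k → Submodule ℂ E) {p : Fin k → ℝ}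
    (hp : ∀ i, 0 ≤ p i) : (flagSum G p).IsPositive :=
  ContinuousLinearMap.isPositive_sum _ fun i _ =>
    (ContinuousLinearMap.IsPositive.of_isStarProjection
      isStarProjection_starProjection).smul_of_nonneg (by exact_mod_cast hp i)

theorem re_inner_flagSum {k : ℕ} (G : Fin k → Submodule ℂ E) (p : Fin k → ℝ) (u : E) :
    (inner ℂ (flagSum G p u) u).re = ∑ i, p i * ‖(G i).starProjection u‖ ^ 2 := by
  rw [flagSum_apply, sum_inner, Complex.re_sum]
  refine Finset.sum_congr rfl fun i _ => ?_
  rw [inner_smul_left, Complex.conj_ofReal, Complex.re_ofReal_mul]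
  exact congrArg _ (re_inner_starProjection_self _ _)

theorem flagSum_mem {k : ℕ} {G : Fin (k + 1) → Submodule ℂ E} (hG : Antitone G)
    (p : Fin (k + 1) → ℝ) (u : E) : flagSum G p u ∈ G 0 := by
  rw [flagSum_apply]
  exact Submodule.sum_mem _ fun i _ => Submodule.smul_mem _ _
    (hG (Fin.zero_le i) (Submodule.starProjection_apply_mem _ _))

theorem flagSum_apply_of_mem {k : ℕ} {G : Fin k → Submodule ℂ E} {p : Fin k → ℝ} {u : E}
    (hu : ∀ i, u ∈ G i) : flagSum G p u = ((∑ i, p i : ℝ) : ℂ) • u := by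
  rw [flagSum_apply, Complex.ofReal_sum, Finset.sum_smul]
  exact Finset.sum_congr rfl fun i _ => by rw [Submodule.starProjection_eq_self_iff.2 (hu i)]

/-- The triangle inequality gives one bound. For the other, nonzero vectors of the smallest subspace
lie in every `G i`, so they are eigenvectors with eigenvalue `∑ pᵢ`. -/
theorem norm_flagSum {k : ℕ} {G : Fin (k + 1) → Submodule ℂ E} (hG : Antitone G)
    (hG0 : ∀ i, G i ≠ ⊥) {p : Fin (k + 1) → ℝ} (hp : ∀ i, 0 ≤ p i) :
    ‖flagSum G p‖ = ∑ i, p i := by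
  refine le_antisymm ?_ ?_
  · refine (norm_sum_le _ _).trans (Finset.sum_le_sum fun i _ => ?_)
    rw [norm_smul, Complex.norm_real, Real.norm_of_nonneg (hp i)]
    exact mul_le_of_le_one_right (hp i) (Submodule.starProjection_norm_le _)
  · obtain ⟨u, hu, hu0⟩ := (Submodule.ne_bot_iff _).1 (hG0 (Fin.last k))
    have h := (flagSum G p).le_opNorm u
    rw [flagSum_apply_of_mem fun i => hG (Fin.le_last i) hu, norm_smul, Complex.norm_real,
      Real.norm_of_nonneg (Finset.sum_nonneg fun i _ => hp i)] at h
    exact le_of_mul_le_mul_right h (norm_pos_iff.2 hu0)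

/-- On a kernel vector the quadratic form `∑ pᵢ ‖Pᵢ v‖²` vanishes term by term, so the vector is
orthogonal to `G 0`; pass to orthogonal complements. -/
theorem range_flagSum {k : ℕ} {G : Fin (k + 1) → Submodule ℂ E} (hG : Antitone G)
    {p : Fin (k + 1) → ℝ} (hp : ∀ i, 0 < p i) : (flagSum G p).range = G 0 := by
  refine le_antisymm ?_ ?_
  · rintro _ ⟨u, rfl⟩
    exact flagSum_mem hG p u
  · have hle : (flagSum G p).rangeᗮ ≤ (G 0)ᗮ := by
      intro v hv
      have hker : flagSum G p v = 0 := by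
        rw [← inner_self_eq_zero (𝕜 := ℂ),
          (flagSum_isPositive G fun i => (hp i).le).inner_left_eq_inner_right]
        exact (Submodule.mem_orthogonal' _ _).1 hv _ ⟨flagSum G p v, rfl⟩
      have h := re_inner_flagSum G p v
      rw [hker, inner_zero_left, Complex.zero_re, eq_comm, Finset.sum_eq_zero_iff_of_nonneg
        fun i _ => mul_nonneg (hp i).le (sq_nonneg _)] at h
      have h0 := h 0 (Finset.mem_univ _)
      rw [mul_eq_zero, or_iff_right (hp 0).ne', sq_eq_zero_iff, norm_eq_zero,
        Submodule.starProjection_apply_eq_zero_iff] at h0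
      exact h0
    have := Submodule.orthogonal_le hle
    rwa [Submodule.orthogonal_orthogonal, Submodule.orthogonal_orthogonal] at this

/-- Every nonzero positive operator has a least positive eigenvalue: subtracting it on the range
gives a positive operator with strictly smaller range. -/
theorem exists_sub_smul_starProjection {A : E →L[ℂ] E} (hA : A.IsPositive) (hA0 : A ≠ 0) :
    ∃ c : ℝ, 0 < c ∧ (A - (c : ℂ) • A.range.starProjection).IsPositive ∧
      (A - (c : ℂ) • A.range.starProjection).range < A.range := by
  set U := A.range with hU
  have hU0 : ∃ u ∈ U, u ≠ 0 := by
    by_contra! h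
    exact hA0 (ContinuousLinearMap.ext fun v => h _ ⟨v, rfl⟩)
  obtain ⟨u, hu, hu0⟩ := hU0
  -- The eigenvalue is found as the minimum of the quadratic form on the unit sphere of the range,
  -- which is compact.
  have hcomp : IsCompact ((U : Set E) ∩ Metric.sphere 0 1) :=
    (isCompact_sphere 0 1).inter_left U.closed_of_finiteDimensional
  have hne : ((U : Set E) ∩ Metric.sphere 0 1).Nonempty := by
    refine ⟨((‖u‖⁻¹ : ℝ) : ℂ) • u, U.smul_mem _ hu, ?_⟩
    rw [mem_sphere_zero_iff_norm, norm_smul, Complex.norm_real, norm_inv, norm_norm,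
      inv_mul_cancel₀ (norm_ne_zero_iff.2 hu0)]
  have hcont : Continuous fun v : E => (inner ℂ (A v) v).re :=
    Complex.continuous_re.comp (A.continuous.inner continuous_id)
  obtain ⟨v, ⟨hvU, hv1⟩, hmin⟩ := hcomp.exists_isMinOn hne hcont.continuousOn
  rw [mem_sphere_zero_iff_norm] at hv1
  have hv0 : v ≠ 0 := fun h => by simp [h] at hv1
  set c := (inner ℂ (A v) v).re with hc
  have hAle (w : E) (hw : w ∈ U) : c * ‖w‖ ^ 2 ≤ (inner ℂ (A w) w).re := by
    by_cases hw0 : w = 0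
    · simp [hw0]
    have hn := norm_ne_zero_iff.2 hw0
    have := hmin (show ((‖w‖⁻¹ : ℝ) : ℂ) • w ∈ (U : Set E) ∩ Metric.sphere 0 1 from
      ⟨U.smul_mem _ hw, by
        rw [mem_sphere_zero_iff_norm, norm_smul, Complex.norm_real, norm_inv, norm_norm,
          inv_mul_cancel₀ hn]⟩)
    simp only [Set.mem_ofPred_eq, map_smul, inner_smul_left, inner_smul_right,
      Complex.conj_ofReal, Complex.re_ofReal_mul] at this
    rw [← hc, ← mul_assoc, ← mul_inv, ← div_eq_inv_mul, le_div_iff₀ (by positivity)] at this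
    rwa [pow_two]
  have hPA (w : E) : U.starProjection (A w) = A w :=
    Submodule.starProjection_eq_self_iff.2 ⟨w, rfl⟩
  have hAP (w : E) : A (U.starProjection w) = A w := by
    refine ext_inner_right ℂ fun x => ?_
    rw [hA.inner_left_eq_inner_right, Submodule.inner_starProjection_left_eq_right, hPA,
      hA.inner_left_eq_inner_right]
  have hPpos : U.starProjection.IsPositive :=
    ContinuousLinearMap.IsPositive.of_isStarProjection isStarProjection_starProjection
  -- If the minimum were zero, the minimiser `v` would lie in both the kernel and the range of `A`.
  have hc0 : 0 < c := by
    refine lt_of_le_of_ne (hA.re_inner_nonneg_left v) fun h => hv0 ?_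
    exact eq_zero_of_mem_ker_of_mem_range hA (apply_eq_zero_of_re_inner_eq_zero hA h.symm) hvU
  have hre (w : E) : (inner ℂ ((A - (c : ℂ) • U.starProjection) w) w).re =
      (inner ℂ (A w) w).re - c * ‖U.starProjection w‖ ^ 2 := by
    rw [sub_apply, smul_apply, inner_sub_left,
      inner_smul_left, Complex.conj_ofReal, Complex.sub_re, Complex.re_ofReal_mul]
    exact congrArg (fun t => _ - c * t) (re_inner_starProjection_self _ _)
  have hpos : (A - (c : ℂ) • U.starProjection).IsPositive := by
    rw [ContinuousLinearMap.isPositive_def']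
    refine ⟨hA.isSelfAdjoint.sub (IsSelfAdjoint.smul (Complex.conj_ofReal c)
      hPpos.isSelfAdjoint), fun w => ?_⟩
    change 0 ≤ (inner ℂ ((A - (c : ℂ) • U.starProjection) w) w).re
    rw [hre]
    have h := hAle _ (Submodule.starProjection_apply_mem U w)
    rw [hAP, ← Submodule.inner_starProjection_left_eq_right, hPA] at h
    linarith
  refine ⟨c, hc0, hpos, lt_of_le_of_ne ?_ fun h => hv0 ?_⟩
  · rintro _ ⟨w, rfl⟩
    exact U.sub_mem ⟨w, rfl⟩ (U.smul_mem _ (Submodule.starProjection_apply_mem U w))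
  -- The form of the difference vanishes at `v`, so `v` is in its kernel; equal ranges would put `v`
  -- in its range as well.
  · refine eq_zero_of_mem_ker_of_mem_range hpos
      (apply_eq_zero_of_re_inner_eq_zero hpos ?_) (h ▸ hvU)
    rw [hre, Submodule.starProjection_eq_self_iff.2 hvU, hv1]
    simp [← hc]

/-- Induction on the rank: peel off the least positive eigenvalue times the projection onto the
range, and prepend the range to the flag of the remainder. The bound by `A.range` keeps the longer
flag strictly decreasing. The zero operator has the empty flag. -/
theorem exists_eq_flagSum {A : E →L[ℂ] E} (hA : A.IsPositive) :
    ∃ (k : ℕ) (G : Fin k → Submodule ℂ E) (p : Fin k → ℝ), StrictAnti G ∧ (∀ i, G i ≠ ⊥) ∧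
      (∀ i, 0 < p i) ∧ (∀ i, G i ≤ A.range) ∧ A = flagSum G p := by
  induction hd : Module.finrank ℂ A.range using Nat.strong_induction_on generalizing A with
  | _ d ih =>
  by_cases hA0 : A = 0
  · exact ⟨0, Fin.elim0, Fin.elim0, fun i => i.elim0, fun i => i.elim0, fun i => i.elim0,
      fun i => i.elim0, by simp [hA0, flagSum]⟩
  obtain ⟨c, hc, hpos, hlt⟩ := exists_sub_smul_starProjection hA hA0
  obtain ⟨k, G, p, hG, hG0, hp, hle, heq⟩ :=
    ih _ (hd ▸ Submodule.finrank_lt_finrank_of_lt hlt) hpos rfl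
  refine ⟨k + 1, Fin.cons A.range G, Fin.cons c p, ?_, ?_, ?_, ?_, ?_⟩
  · intro i j hij
    induction j using Fin.cases with
    | zero => exact absurd hij (Fin.not_lt_zero i)
    | succ j =>
      induction i using Fin.cases with
      | zero => simpa using (hle j).trans_lt hlt
      | succ i => simpa using hG (Fin.succ_lt_succ_iff.1 hij)
  · refine Fin.cases ?_ fun i => by simpa using hG0 i
    simpa using bot_lt_iff_ne_bot.1 (bot_le.trans_lt hlt)
  · exact Fin.cases (by simpa using hc) fun i => by simpa using hp i
  · exact Fin.cases (by simp) fun i => by simpa using (hle i).trans hlt.le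
  · rw [flagSum_succ]
    simp only [Fin.cons_zero, Fin.cons_succ]
    rw [← heq, add_sub_cancel]

/-- Evaluate both quadratic forms at some `v ≠ 0` in `H 0` orthogonal to the rest of the flag `H`:
one is `q 0 * ‖v‖ ^ 2`, the other at least `p 0 * ‖v‖ ^ 2`. Used in both directions, it identifies
the first weights. -/
theorem flagSum_weight_zero_le {k l : ℕ} {G : Fin (k + 1) → Submodule ℂ E}
    {H : Fin (l + 1) → Submodule ℂ E} {p : Fin (k + 1) → ℝ} {q : Fin (l + 1) → ℝ}
    (hH : StrictAnti H) (hH0 : ∀ i, H i ≠ ⊥) (hp : ∀ i, 0 ≤ p i)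
    (hGH : H 0 = G 0) (h : flagSum G p = flagSum H q) : p 0 ≤ q 0 := by
  obtain ⟨v, hv, hv0, hvo⟩ : ∃ v ∈ H 0, v ≠ 0 ∧ ∀ i : Fin l, (H i.succ).starProjection v = 0 := by
    cases l with
    | zero =>
      obtain ⟨v, hv, hv0⟩ := (Submodule.ne_bot_iff _).1 (hH0 0)
      exact ⟨v, hv, hv0, fun i => i.elim0⟩
    | succ l =>
      have hlt : H 1 < H 0 := hH (by simp)
      obtain ⟨w, hw, hw'⟩ := SetLike.exists_of_lt hlt
      refine ⟨w - (H 1).starProjection w,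
        (H 0).sub_mem hw (hlt.le (Submodule.starProjection_apply_mem _ _)), fun h0 => hw' ?_,
        fun i => ?_⟩
      · rw [sub_eq_zero] at h0
        rw [h0]
        exact Submodule.starProjection_apply_mem _ _
      · rw [Submodule.starProjection_apply_eq_zero_iff]
        refine Submodule.orthogonal_le (hH.antitone ?_)
          (Submodule.sub_starProjection_mem_orthogonal (K := H 1) w)
        exact Fin.succ_le_succ_iff.2 (Fin.zero_le i)
  have hq := re_inner_flagSum H q v
  have hp' := re_inner_flagSum G p v
  rw [Fin.sum_univ_succ] at hq hp'
  simp only [hvo, norm_zero] at hq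
  rw [Submodule.starProjection_eq_self_iff.2 hv] at hq
  rw [Submodule.starProjection_eq_self_iff.2 (hGH ▸ hv)] at hp'
  rw [h] at hp'
  have hnn : 0 ≤ ∑ i : Fin k, p i.succ * ‖(G i.succ).starProjection v‖ ^ 2 :=
    Finset.sum_nonneg fun i _ => mul_nonneg (hp _) (sq_nonneg _)
  have hv2 : 0 < ‖v‖ ^ 2 := by have := norm_pos_iff.2 hv0; positivity
  refine le_of_mul_le_mul_right ?_ hv2
  simp at hq
  linarith

theorem flagSum_ne_zero {k : ℕ} {G : Fin (k + 1) → Submodule ℂ E} (hG : Antitone G)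
    (hG0 : ∀ i, G i ≠ ⊥) {p : Fin (k + 1) → ℝ} (hp : ∀ i, 0 < p i) : flagSum G p ≠ 0 := by
  rw [← norm_ne_zero_iff, norm_flagSum hG hG0 fun i => (hp i).le]
  exact (Finset.sum_pos (fun i _ => hp i) Finset.univ_nonempty).ne'

/-- The range recovers the first subspace and the previous comparison the first weight; cancel that
term and induct. -/
theorem flagSum_injective {k l : ℕ} {G : Fin k → Submodule ℂ E}
    {H : Fin l → Submodule ℂ E} {p : Fin k → ℝ} {q : Fin l → ℝ}
    (hG : StrictAnti G) (hG0 : ∀ i, G i ≠ ⊥) (hp : ∀ i, 0 < p i)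
    (hH : StrictAnti H) (hH0 : ∀ i, H i ≠ ⊥) (hq : ∀ i, 0 < q i)
    (h : flagSum G p = flagSum H q) :
    ∃ e : k = l, (∀ i, G i = H (Fin.cast e i)) ∧ ∀ i, p i = q (Fin.cast e i) := by
  induction k generalizing l with
  | zero =>
    cases l with
    | zero => exact ⟨rfl, fun i => i.elim0, fun i => i.elim0⟩
    | succ l =>
      refine absurd h.symm ?_
      simpa [flagSum] using flagSum_ne_zero hH.antitone hH0 hq
  | succ k ih =>
    cases l with
    | zero =>
      refine absurd h ?_
      simpa [flagSum] using flagSum_ne_zero hG.antitone hG0 hp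
    | succ l =>
      have h0 : G 0 = H 0 := by
        rw [← range_flagSum hG.antitone hp, h, range_flagSum hH.antitone hq]
      have hpq : p 0 = q 0 := le_antisymm
        (flagSum_weight_zero_le hH hH0 (fun i => (hp i).le) h0.symm h)
        (flagSum_weight_zero_le hG hG0 (fun i => (hq i).le) h0 h.symm)
      rw [flagSum_succ, flagSum_succ, h0, hpq, add_right_inj] at h
      obtain ⟨e, h1, h2⟩ := ih (hG.comp_strictMono (Fin.strictMono_succ))
        (fun i => hG0 _) (fun i => hp _) (hH.comp_strictMono (Fin.strictMono_succ))
        (fun i => hH0 _) (fun i => hq _) h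
      subst e
      exact ⟨rfl, Fin.cases h0 h1, Fin.cases hpq h2⟩

end FlagSum

/-! ### Nondegenerate representatives in a homotopy colimit -/

namespace TopDiagram

universe u v

variable {P : Type u} [TopologicalSpace P] [PartialOrder P] {D : TopDiagram.{u, v} P}

theorem restrict_of_eq (z : D.Total) (q : P) (h : q ≤ D.base z) (hq : q = D.base z) :
    D.restrict z q h = z := by
  subst hq
  exact D.restrict_self z

/-- Only the chain needs checking: the two restrictions compose to the one from `G 0` to `G (δ (σ
0)) = G 0`, which is the identity. -/
theorem Simplex.pull_pull_eq {k l : ℕ} (δ : Fin (k + 1) →o Fin (l + 1))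
    (σ : Fin (l + 1) →o Fin (k + 1)) (s : D.Simplex l) (h : ∀ j, s.1.1 (δ (σ j)) = s.1.1 j) :
    (s.pull δ).pull σ = s := by
  refine Subtype.ext (Prod.ext (funext h) ?_)
  exact (D.restrict_restrict _ _ _ _ _).trans (restrict_of_eq _ _ _ ((h 0).trans s.2.2.symm))

theorem exists_map_succAbove_eq {k : ℕ} (p : stdSimplex ℝ (Fin (k + 2))) (j : Fin (k + 2))
    (hj : p j = 0) : ∃ q : stdSimplex ℝ (Fin (k + 1)),
      stdSimplex.map (Fin.succAboveOrderEmb j).toOrderHom q = p := by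
  refine ⟨⟨fun i => p (j.succAbove i), fun i => p.2.1 _, ?_⟩, ?_⟩
  · have h := p.2.2
    rw [Fin.sum_univ_succAbove _ j] at h
    change p j + _ = _ at h
    rw [hj, zero_add] at h
    exact h
  · ext i
    rw [stdSimplex.map_coe, FunOnFinite.linearMap_apply_apply]
    induction i using Fin.succAboveCases j with
    | x =>
      refine Eq.trans ?_ hj.symm
      exact Finset.sum_eq_zero fun a ha => absurd (Finset.mem_filter.1 ha).2 (Fin.succAbove_ne j a)
    | p i =>
      rw [Finset.sum_eq_single i]
      · rfl
      · intro b hb hbi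
        exact absurd (Fin.succAbove_right_injective (Finset.mem_filter.1 hb).2) hbi
      · intro hi
        refine absurd ?_ hi
        rw [Finset.mem_filter]
        exact ⟨Finset.mem_univ i, rfl⟩

/-- Every point of the homotopy colimit is represented by an interior point of a nondegenerate
simplex. -/
theorem exists_nondegenerate (x : D.Hocolim) : ∃ (k : ℕ) (s : D.Simplex k)
    (p : stdSimplex ℝ (Fin (k + 1))),
      Quot.mk D.Glue ⟨k, (s, p)⟩ = x ∧ StrictAnti s.1.1 ∧ ∀ i, 0 < p i := by
  obtain ⟨⟨k, s, p⟩, rfl⟩ := Quot.exists_rep x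
  induction k with
  | zero =>
    have : Subsingleton (Fin (0 + 1)) := inferInstanceAs (Subsingleton (Fin 1))
    refine ⟨0, s, p, rfl, Subsingleton.strictAnti _, fun i => ?_⟩
    have h := p.2.2
    rw [Fin.sum_univ_one] at h
    rw [Subsingleton.elim i 0]
    exact one_pos.trans_eq h.symm
  | succ k ih =>
    -- A vanishing coordinate puts the point on a face, of lower dimension.
    by_cases hp : ∃ j, p j = 0
    · obtain ⟨j, hj⟩ := hp
      obtain ⟨q, hq⟩ := exists_map_succAbove_eq p j hj
      obtain ⟨k', s', p', h, hs', hp'⟩ := ih (s.pull (Fin.succAboveOrderEmb j).toOrderHom) q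
      refine ⟨k', s', p', h.trans ?_, hs', hp'⟩
      rw [← hq]
      exact Quot.sound (Glue.glue _ s q)
    push Not at hp
    by_cases hs : StrictAnti s.1.1
    · exact ⟨k + 1, s, p, rfl, hs, fun i => lt_of_le_of_ne (p.2.1 i) (hp i).symm⟩
    rw [Fin.strictAnti_iff_succ_lt] at hs
    push Not at hs
    obtain ⟨i, hi⟩ := hs
    have hi' : s.1.1 i.castSucc = s.1.1 i.succ := by
      by_contra hne
      exact hi (lt_of_le_of_ne (s.2.1 i.castSucc_lt_succ.le) (Ne.symm hne))
    -- The subspaces at positions `i` and `i + 1` agree, so deleting one and repeating the other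
    -- gives `s` back: `s` is degenerate.
    have hpull : (s.pull (Fin.succAboveOrderEmb i.succ).toOrderHom).pull
        (Fin.predAboveOrderHom i) = s := by
      refine Simplex.pull_pull_eq _ _ s fun j => ?_
      change s.1.1 (i.succ.succAbove (i.predAbove j)) = _
      by_cases hj : j = i.succ
      · rw [hj, Fin.predAbove_succ_self, Fin.succAbove_succ_self, hi']
      · rw [Fin.succ_succAbove_predAbove hj]
    obtain ⟨k', s', p', h, hs', hp'⟩ := ih (s.pull (Fin.succAboveOrderEmb i.succ).toOrderHom)
      (stdSimplex.map (Fin.predAboveOrderHom i) p)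
    refine ⟨k', s', p', h.trans ?_, hs', hp'⟩
    conv_rhs => rw [← hpull]
    exact (Quot.sound (Glue.glue _ _ p)).symm

end TopDiagram

/-! ### Compactness of the homotopy colimit -/

section Compact

variable {m : ℕ} {V W : Type*} [NormedAddCommGroup V] [InnerProductSpace ℂ V]
  [NormedAddCommGroup W] [InnerProductSpace ℂ W]

theorem NonzeroSubspace.continuous_starProjection :
    Continuous fun U : NonzeroSubspace m => U.1.starProjection :=
  continuous_induced_dom (f := fun U : NonzeroSubspace m => U.1.starProjection)

theorem NonzeroSubspace.continuous_starProjection_apply (u : EuclideanSpace ℂ (Fin m)) :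
    Continuous fun U : NonzeroSubspace m => U.1.starProjection u :=
  (ContinuousLinearMap.apply ℂ _ u).continuous.comp continuous_starProjection

/-- Expresses the order by equations between projections, so that it is visibly a closed relation.
-/
theorem NonzeroSubspace.le_iff_starProjection {U U' : NonzeroSubspace m} :
    U ≤ U' ↔ ∀ u, U'.1.starProjection (U.1.starProjection u) = U.1.starProjection u := by
  refine ⟨fun h u => Submodule.starProjection_eq_self_iff.2
    (h (Submodule.starProjection_apply_mem _ _)), fun h u hu => ?_⟩
  have := h u
  rw [Submodule.starProjection_eq_self_iff.2 hu] at this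
  exact Submodule.starProjection_eq_self_iff.1 this

instance : OrderClosedTopology (NonzeroSubspace m) where
  isClosed_le' := by
    simp only [NonzeroSubspace.le_iff_starProjection, Set.ofPred_forall]
    refine isClosed_iInter fun u => isClosed_eq ?_ ?_
    · exact (NonzeroSubspace.continuous_starProjection.comp continuous_snd).clm_apply
        ((NonzeroSubspace.continuous_starProjection_apply u).comp continuous_fst)
    · exact (NonzeroSubspace.continuous_starProjection_apply u).comp continuous_fst

instance : CompactSpace (NonzeroSubspace m) := by
  have hproper : ProperSpace (EuclideanSpace ℂ (Fin m) →L[ℂ] EuclideanSpace ℂ (Fin m)) :=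
    FiniteDimensional.proper ℂ _
  have hind : Topology.IsInducing fun U : NonzeroSubspace m => U.1.starProjection := ⟨rfl⟩
  rw [← isCompact_univ_iff, hind.isCompact_iff]
  -- Nonzero subspaces correspond to self-adjoint idempotents of norm one; the norm condition
  -- excludes the zero subspace.
  have hrange : (fun U : NonzeroSubspace m => U.1.starProjection) '' Set.univ =
      Metric.sphere 0 1 ∩ {p | p * p = p ∧ star p = p} := by
    ext p
    constructor
    · rintro ⟨U, -, rfl⟩
      have h : IsStarProjection U.1.starProjection := isStarProjection_starProjection
      exact ⟨mem_sphere_zero_iff_norm.2 (Submodule.norm_starProjection _ U.2),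
        h.isIdempotentElem, h.isSelfAdjoint⟩
    · rintro ⟨h1, h2, h3⟩
      obtain ⟨U, _, rfl⟩ := (isStarProjection_iff_eq_starProjection (p := p)).1
        ⟨h2, h3⟩
      refine ⟨⟨U, ?_⟩, trivial, rfl⟩
      rintro rfl
      simp at h1
  rw [hrange]
  refine (isCompact_sphere _ _).inter_right (IsClosed.inter ?_ ?_)
  · exact isClosed_eq (continuous_id.mul continuous_id) continuous_id
  · exact isClosed_eq continuous_star continuous_id

theorem StiefelTotal.norm_extend_apply (z : StiefelTotal m V W) (u : EuclideanSpace ℂ (Fin m))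
    (v : V) : ‖z.extend (WithLp.toLp 2 (u, v))‖ ^ 2 =
      ‖z.dom.1.starProjection u‖ ^ 2 + ‖v‖ ^ 2 := by
  rw [z.extend_apply, LinearIsometry.norm_map, WithLp.prod_norm_sq_eq_of_L2]
  rfl

/-- The norm identity characterises extensions by zero: it makes `T` isometric on `U ⊕ V` and zero
on `Uᗮ`. It is a closed condition, whence compactness of the total space, and it also constructs `z`
in the surjectivity proof. -/
theorem StiefelTotal.exists_eq_extend (U : NonzeroSubspace m)
    (T : WithLp 2 (EuclideanSpace ℂ (Fin m) × V) →L[ℂ] W)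
    (hT : ∀ u v, ‖T (WithLp.toLp 2 (u, v))‖ ^ 2 = ‖U.1.starProjection u‖ ^ 2 + ‖v‖ ^ 2) :
    ∃ z : StiefelTotal m V W, z.dom = U ∧ z.extend = T := by
  refine ⟨⟨U, ⟨⟨⟨fun x => T (WithLp.toLp 2 ((x.fst : EuclideanSpace ℂ (Fin m)), x.snd)), ?_⟩, ?_⟩,
    ?_⟩⟩, rfl, ?_⟩
  · intro x y
    rw [← map_add]
    rfl
  · intro c x
    rw [RingHom.id_apply, ← map_smul]
    rfl
  · intro x
    rw [← sq_eq_sq₀ (norm_nonneg _) (norm_nonneg _), WithLp.prod_norm_sq_eq_of_L2]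
    change ‖T (WithLp.toLp 2 ((x.fst : EuclideanSpace ℂ (Fin m)), x.snd))‖ ^ 2 = _
    rw [hT, Submodule.starProjection_eq_self_iff.2 x.fst.2]
    rfl
  · ext ⟨u, v⟩
    rw [StiefelTotal.extend_apply]
    change T (WithLp.toLp 2 (U.1.starProjection u, v)) = T (WithLp.toLp 2 (u, v))
    rw [← sub_eq_zero, ← map_sub, ← WithLp.toLp_sub, Prod.mk_sub_mk, sub_self,
      ← norm_eq_zero, ← sq_eq_zero_iff, hT, map_sub,
      Submodule.starProjection_eq_self_iff.2 (Submodule.starProjection_apply_mem _ _)]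
    simp

instance [FiniteDimensional ℂ V] [FiniteDimensional ℂ W] :
    CompactSpace (StiefelTotal m V W) := by
  have hfd : FiniteDimensional ℂ (WithLp 2 (EuclideanSpace ℂ (Fin m) × V)) := inferInstance
  have hproper : ProperSpace (WithLp 2 (EuclideanSpace ℂ (Fin m) × V) →L[ℂ] W) :=
    FiniteDimensional.proper ℂ (WithLp 2 (EuclideanSpace ℂ (Fin m) × V) →L[ℂ] W)
  have hind : Topology.IsInducing fun z : StiefelTotal m V W => (z.dom, z.extend) := ⟨rfl⟩
  rw [← isCompact_univ_iff, hind.isCompact_iff]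
  have hrange : (fun z : StiefelTotal m V W => (z.dom, z.extend)) '' Set.univ =
      Set.univ ×ˢ Metric.closedBall 0 1 ∩ ⋂ u, ⋂ v, {x : NonzeroSubspace m ×
        (WithLp 2 (EuclideanSpace ℂ (Fin m) × V) →L[ℂ] W) | ‖x.2 (WithLp.toLp 2 (u, v))‖ ^ 2 =
        ‖x.1.1.starProjection u‖ ^ 2 + ‖v‖ ^ 2} := by
    ext ⟨U, T⟩
    simp only [Set.image_univ, Set.mem_range, Prod.mk.injEq, Set.mem_inter_iff, Set.mem_prod,
      Set.mem_univ, true_and, Set.mem_iInter, Set.mem_ofPred_eq]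
    constructor
    · rintro ⟨z, rfl, rfl⟩
      have hle : ‖z.extend‖ ≤ 1 := by
        refine ContinuousLinearMap.opNorm_le_bound _ zero_le_one fun x => ?_
        rw [one_mul, ← sq_le_sq₀ (norm_nonneg _) (norm_nonneg _), WithLp.prod_norm_sq_eq_of_L2]
        refine (z.norm_extend_apply x.fst x.snd).trans_le ?_
        gcongr
        exact Submodule.norm_starProjection_apply_le _ _
      exact ⟨(mem_closedBall_zero_iff
        (E := WithLp 2 (EuclideanSpace ℂ (Fin m) × V) →L[ℂ] W)).2 hle, z.norm_extend_apply⟩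
    · rintro ⟨-, h⟩
      exact StiefelTotal.exists_eq_extend U T h
  rw [hrange]
  refine (isCompact_univ.prod (isCompact_closedBall _ _)).inter_right
    (isClosed_iInter fun u => isClosed_iInter fun v => isClosed_eq ?_ ?_)
  · exact (((ContinuousLinearMap.apply ℂ W _).continuous.comp continuous_snd).norm).pow 2
  · exact ((((NonzeroSubspace.continuous_starProjection_apply u).comp
      continuous_fst).norm).pow 2).add continuous_const

instance [FiniteDimensional ℂ V] [FiniteDimensional ℂ W] (k : ℕ) :
    CompactSpace ((stiefelDiagram m V W).Simplex k) := by
  have : CompactSpace (stiefelDiagram m V W).Total :=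
    inferInstanceAs (CompactSpace (StiefelTotal m V W))
  refine isCompact_iff_compactSpace.1 (IsClosed.isCompact (IsClosed.inter ?_ ?_))
  · exact isClosed_antitone.preimage continuous_fst
  · exact isClosed_eq ((stiefelDiagram m V W).continuous_base.comp continuous_snd)
      ((continuous_apply 0).comp continuous_fst)

/-- The `k + 1` dimensions are distinct integers between `1` and `m`. Hence finitely many simplex
spaces cover the homotopy colimit. -/
theorem NonzeroSubspace.length_lt_of_strictAnti {k : ℕ} {G : Fin (k + 1) → NonzeroSubspace m}
    (hG : StrictAnti G) : k < m := by
  have hanti : StrictAnti fun i => Module.finrank ℂ (G i).1 := fun i j hij =>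
    Submodule.finrank_lt_finrank_of_lt (hG hij)
  have h := Finset.card_le_card_of_injOn (s := Finset.univ) (t := Finset.Icc 1 m)
    (fun i => Module.finrank ℂ (G i).1) (fun i _ => ?_) hanti.injective.injOn
  · simpa using h
  · rw [Finset.coe_Icc]
    refine ⟨Submodule.one_le_finrank_iff.2 (G i).2, (Submodule.finrank_le _).trans_eq ?_⟩
    simp

instance [FiniteDimensional ℂ V] [FiniteDimensional ℂ W] : CompactSpace (StiefelHocolim m V W) := by
  let f (k : ℕ) (x : (stiefelDiagram m V W).Simplex k × stdSimplex ℝ (Fin (k + 1))) :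
    StiefelHocolim m V W := Quot.mk _ ⟨k, x⟩
  have hf (k : ℕ) : Continuous (f k) := continuous_quot_mk.comp continuous_sigmaMk
  have huniv : (Set.univ : Set (StiefelHocolim m V W)) =
      ⋃ k ∈ Finset.range m, Set.range (f k) := by
    refine (Set.eq_univ_of_forall fun x => ?_).symm
    obtain ⟨k, s, p, hx, hs, -⟩ := TopDiagram.exists_nondegenerate x
    exact Set.mem_biUnion (Finset.mem_range.2 (NonzeroSubspace.length_lt_of_strictAnti hs))
      ⟨(s, p), hx⟩
  rw [← isCompact_univ_iff, huniv]
  exact (Finset.range m).isCompact_biUnion fun k _ => isCompact_range (hf k)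

end Compact

/-! ### Polar decomposition -/

section Polar

variable {E W : Type*} [NormedAddCommGroup E] [InnerProductSpace ℂ E] [FiniteDimensional ℂ E]
  [NormedAddCommGroup W] [InnerProductSpace ℂ W]

/-- The norms determine the form of `A²`, hence `A²`, and positive square roots are unique. This is
the uniqueness of the absolute value. -/
theorem isPositive_ext_of_norm_apply_eq {A B : E →L[ℂ] E} (hA : A.IsPositive) (hB : B.IsPositive)
    (h : ∀ u, ‖A u‖ = ‖B u‖) : A = B := by
  have hsq : A * A = B * B := by
    refine ContinuousLinearMap.coe_inj.1 ((ext_inner_map _ _).1 fun u => ?_)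
    change inner ℂ (A (A u)) u = inner ℂ (B (B u)) u
    rw [hA.inner_left_eq_inner_right, hB.inner_left_eq_inner_right, inner_self_eq_norm_sq_to_K,
      inner_self_eq_norm_sq_to_K, h]
  rw [← CFC.sqrt_unique hsq ((ContinuousLinearMap.nonneg_iff_isPositive A).2 hA)]
  exact CFC.sqrt_unique rfl ((ContinuousLinearMap.nonneg_iff_isPositive B).2 hB)

/-- Polar decomposition: `T = S A` with `A` positive and `S` a partial isometry defined on the
range of `A`. -/
theorem exists_polar_decomposition [FiniteDimensional ℂ W] (T : E →L[ℂ] W) :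
    ∃ (A : E →L[ℂ] E) (S : E →L[ℂ] W), A.IsPositive ∧ (∀ u, S (A u) = T u) ∧
      (∀ u, ‖S u‖ = ‖A.range.starProjection u‖) ∧ ∀ u, S u ∈ T.range := by
  set B : E →L[ℂ] E := T.adjoint ∘L T with hB
  have hBpos : 0 ≤ B := (ContinuousLinearMap.nonneg_iff_isPositive _).2
    (ContinuousLinearMap.isPositive_adjoint_comp_self T)
  set A := CFC.sqrt B with hAdef
  have hA : A.IsPositive :=
    (ContinuousLinearMap.nonneg_iff_isPositive _).1 (CFC.sqrt_nonneg B)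
  have hAA : A * A = B := CFC.sqrt_mul_sqrt_self B
  have hnorm (u : E) : ‖A u‖ = ‖T u‖ := by
    rw [← sq_eq_sq₀ (norm_nonneg _) (norm_nonneg _), ← inner_self_eq_norm_sq (𝕜 := ℂ),
      ← inner_self_eq_norm_sq (𝕜 := ℂ), ← hA.inner_left_eq_inner_right,
      ← ContinuousLinearMap.adjoint_inner_left]
    change RCLike.re (inner ℂ ((A * A) u) u) = _
    rw [hAA]
    rfl
  -- Take `S = T ∘ g` on the range of `A`, for any linear section `g` of `A`. By `hnorm` the kernel
  -- of `A` is killed by `T`, so `S (A u) = T u` whatever the section.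
  obtain ⟨g, hg⟩ := A.toLinearMap.rangeRestrict.exists_rightInverse_of_surjective
    A.toLinearMap.range_rangeRestrict
  have hg' (u : A.range) : A (g u) = u := congrArg Subtype.val (LinearMap.congr_fun hg u)
  refine ⟨A, (T.toLinearMap ∘ₗ g ∘ₗ
    A.range.orthogonalProjectionOnto.toLinearMap).toContinuousLinearMap, hA, fun u => ?_,
    fun u => ?_, fun u => ⟨_, rfl⟩⟩
  · change T (g (A.range.orthogonalProjectionOnto (A u))) = T u
    rw [← sub_eq_zero, ← map_sub, ← norm_eq_zero, ← hnorm, map_sub, hg', norm_eq_zero, sub_eq_zero]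
    exact Submodule.starProjection_eq_self_iff.2 ⟨u, rfl⟩
  · change ‖T (g (A.range.orthogonalProjectionOnto u))‖ = _
    rw [← hnorm, hg']
    rfl

end Polar

/-! ### Tensors as linear maps -/

section Tensor

variable {m : ℕ} {V W : Type*} [NormedAddCommGroup V] [InnerProductSpace ℂ V]
  [NormedAddCommGroup W] [InnerProductSpace ℂ W]

/-- The identification of linear maps `ℂᵐ → W` with tensors in `ℂᵐ ⊗ W`, by the standard basis. -/
def toTensor : (EuclideanSpace ℂ (Fin m) →L[ℂ] W) →ₗ[ℂ] EuclideanSpace ℂ (Fin m) ⊗[ℂ] W where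
  toFun T := ∑ i, EuclideanSpace.single i 1 ⊗ₜ T (EuclideanSpace.single i 1)
  map_add' S T := by simp [TensorProduct.tmul_add, Finset.sum_add_distrib]
  map_smul' c T := by simp [Finset.smul_sum]

theorem toTensor_apply (T : EuclideanSpace ℂ (Fin m) →L[ℂ] W) :
    toTensor T = ∑ i, EuclideanSpace.single i 1 ⊗ₜ[ℂ] T (EuclideanSpace.single i 1) := rfl

theorem clm_ext_single {S T : EuclideanSpace ℂ (Fin m) →L[ℂ] W}
    (h : ∀ i, S (EuclideanSpace.single i 1) = T (EuclideanSpace.single i 1)) : S = T := by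
  refine ContinuousLinearMap.coe_inj.1
    ((EuclideanSpace.basisFun (Fin m) ℂ).toBasis.ext fun i => ?_)
  simpa using h i

theorem toTensor_injective :
    Function.Injective (toTensor : (EuclideanSpace ℂ (Fin m) →L[ℂ] W) →ₗ[ℂ] _) := by
  refine (injective_iff_map_eq_zero _).2 fun T hT => clm_ext_single fun j => ?_
  refine ext_inner_right ℂ fun w => ?_
  have h := congrArg (fun x => inner ℂ x (EuclideanSpace.single j 1 ⊗ₜ[ℂ] w)) hT
  simpa [toTensor_apply, sum_inner, EuclideanSpace.inner_single_left, Pi.single_apply] using h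

theorem toTensor_mem_complementFibre {T : EuclideanSpace ℂ (Fin m) →L[ℂ] W} (f : V →ₗᵢ[ℂ] W)
    (hT : ∀ u, T u ∈ (LinearMap.range f.toLinearMap)ᗮ) : toTensor T ∈ complementFibre m f := by
  rw [toTensor_apply]
  exact (complementFibre m f).sum_mem fun i _ => ⟨EuclideanSpace.single i 1 ⊗ₜ ⟨T _, hT _⟩, rfl⟩

theorem exists_toTensor_eq {f : V →ₗᵢ[ℂ] W} {x : EuclideanSpace ℂ (Fin m) ⊗[ℂ] W}
    (hx : x ∈ complementFibre m f) : ∃ T : EuclideanSpace ℂ (Fin m) →L[ℂ] W,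
      (∀ u, T u ∈ (LinearMap.range f.toLinearMap)ᗮ) ∧ toTensor T = x := by
  obtain ⟨y, rfl⟩ := hx
  induction y with
  | zero => exact ⟨0, fun u => Submodule.zero_mem _, by simp⟩
  | add a b ha hb =>
    obtain ⟨S, hS, hS'⟩ := ha
    obtain ⟨T, hT, hT'⟩ := hb
    exact ⟨S + T, fun u => Submodule.add_mem _ (hS u) (hT u), by rw [map_add, map_add, hS', hT']⟩
  | tmul e w =>
    -- The map `u ↦ (∑ eᵢ uᵢ) w`, with the bilinear rather than the Hermitian pairing.
    refine ⟨(∑ i, e i • EuclideanSpace.proj i).smulRight (w : W),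
      fun u => Submodule.smul_mem _ _ w.2, ?_⟩
    have he : e = ∑ i, e i • EuclideanSpace.single i (1 : ℂ) := by
      ext j
      simp [Pi.single_apply]
    rw [LinearMap.lTensor_tmul, toTensor_apply]
    conv_rhs => rw [he, TensorProduct.sum_tmul]
    refine Finset.sum_congr rfl fun i _ => ?_
    rw [TensorProduct.smul_tmul]
    congr 1
    simp

theorem continuous_toTensor [FiniteDimensional ℂ W] :
    Continuous (toTensor : (EuclideanSpace ℂ (Fin m) →L[ℂ] W) →ₗ[ℂ] _) :=
  LinearMap.continuous_of_finiteDimensional _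

variable [RealStructure W]

/-- The standard basis vectors are fixed by conjugation. -/
theorem toTensor_conj {S T : EuclideanSpace ℂ (Fin m) →L[ℂ] W}
    (h : ∀ u, S u = conj (T (conj u))) : toTensor S = conjTensor (toTensor T) := by
  rw [toTensor_apply, toTensor_apply, map_sum]
  refine Finset.sum_congr rfl fun i _ => ?_
  have hi : conj (EuclideanSpace.single i (1 : ℂ) : EuclideanSpace ℂ (Fin m)) =
      EuclideanSpace.single i 1 := by
    ext j
    change starRingEnd ℂ ((EuclideanSpace.single i (1 : ℂ) : EuclideanSpace ℂ (Fin m)) j) = _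
    by_cases hj : j = i <;> simp [hj]
  rw [conjTensor_tmul, h, hi]

end Tensor

/-! ### From the homotopy colimit to the sphere bundle -/

section Comparison

variable {m : ℕ} {V W : Type*} [NormedAddCommGroup V] [InnerProductSpace ℂ V]
  [NormedAddCommGroup W] [InnerProductSpace ℂ W]

namespace StiefelTotal

/-- The restriction of an isometry `U ⊕ V → W` to `V`. -/
def restrictRight (z : StiefelTotal m V W) : V →ₗᵢ[ℂ] W where
  toFun v := z.extend (WithLp.toLp 2 (0, v))
  map_add' v w := by rw [← map_add, ← WithLp.toLp_add, Prod.mk_add_mk, add_zero]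
  map_smul' c v := by rw [RingHom.id_apply, ← map_smul, ← WithLp.toLp_smul, Prod.smul_mk, smul_zero]
  norm_map' v := by
    rw [← sq_eq_sq₀ (norm_nonneg _) (norm_nonneg _)]
    exact (z.norm_extend_apply 0 v).trans (by simp)

theorem restrictRight_apply (z : StiefelTotal m V W) (v : V) :
    z.restrictRight v = z.extend (WithLp.toLp 2 (0, v)) := rfl

/-- The restriction of an isometry `U ⊕ V → W` to `U`, extended by zero on `Uᗮ`. -/
def extendLeft (z : StiefelTotal m V W) : EuclideanSpace ℂ (Fin m) →L[ℂ] W :=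
  z.extend ∘L (WithLp.prodContinuousLinearEquiv 2 ℂ
    (EuclideanSpace ℂ (Fin m)) V).symm.toContinuousLinearMap ∘L
      ContinuousLinearMap.inl ℂ (EuclideanSpace ℂ (Fin m)) V

theorem extendLeft_apply (z : StiefelTotal m V W) (u : EuclideanSpace ℂ (Fin m)) :
    z.extendLeft u = z.extend (WithLp.toLp 2 (u, 0)) := rfl

theorem norm_extendLeft_apply (z : StiefelTotal m V W) (u : EuclideanSpace ℂ (Fin m)) :
    ‖z.extendLeft u‖ = ‖z.dom.1.starProjection u‖ := by
  rw [← sq_eq_sq₀ (norm_nonneg _) (norm_nonneg _)]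
  exact (z.norm_extend_apply u 0).trans (by simp)

theorem extendLeft_mem_orthogonal (z : StiefelTotal m V W) (u : EuclideanSpace ℂ (Fin m)) :
    z.extendLeft u ∈ (LinearMap.range z.restrictRight.toLinearMap)ᗮ := by
  rw [Submodule.mem_orthogonal]
  rintro _ ⟨v, rfl⟩
  change inner ℂ (z.extend (WithLp.toLp 2 (0, v))) (z.extend (WithLp.toLp 2 (u, 0))) = 0
  rw [extend_apply, extend_apply]
  refine (LinearIsometry.inner_map_map (𝕜 := ℂ) (E := WithLp 2 (z.dom.1 × V)) z.iso _ _).trans ?_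
  rw [WithLp.prod_inner_apply]
  simp

theorem ext_extend {z z' : StiefelTotal m V W} (h : z.dom = z'.dom)
    (hl : ∀ u ∈ z.dom.1, z.extendLeft u = z'.extendLeft u)
    (hr : z.restrictRight = z'.restrictRight) : z = z' := by
  have key (y : StiefelTotal m V W) (u : EuclideanSpace ℂ (Fin m)) (hu : u ∈ y.dom.1) (v : V) :
      y.iso (WithLp.toLp 2 (⟨u, hu⟩, v)) = y.extendLeft u + y.restrictRight v := by
    rw [← y.extend_coe, extendLeft_apply, restrictRight_apply, ← map_add, ← WithLp.toLp_add,
      Prod.mk_add_mk, add_zero, zero_add]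
  refine ext_of h fun u hu hu' v => ?_
  rw [key z u hu, key z' u hu', hl u hu, hr]

theorem continuous_restrictRight :
    Continuous (restrictRight : StiefelTotal m V W → V →ₗᵢ[ℂ] W) := by
  refine continuous_induced_rng.2 ?_
  have h : (LinearIsometry.toContinuousLinearMap ∘ restrictRight : StiefelTotal m V W → V →L[ℂ] W) =
      fun z => z.extend ∘L ((WithLp.prodContinuousLinearEquiv 2 ℂ
        (EuclideanSpace ℂ (Fin m)) V).symm.toContinuousLinearMap ∘L
          ContinuousLinearMap.inr ℂ (EuclideanSpace ℂ (Fin m)) V) := rfl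
  rw [h]
  exact continuous_extend.clm_comp continuous_const

theorem continuous_extendLeft :
    Continuous (extendLeft : StiefelTotal m V W → EuclideanSpace ℂ (Fin m) →L[ℂ] W) :=
  continuous_extend.clm_comp continuous_const

theorem restrictRight_restrict (z : StiefelTotal m V W) (U : NonzeroSubspace m) (h : U ≤ z.dom) :
    (z.restrict U h).restrictRight = z.restrictRight := by
  ext v
  rw [restrictRight_apply, extend_restrict, restrictRight_apply]
  simp

theorem extendLeft_restrict (z : StiefelTotal m V W) (U : NonzeroSubspace m) (h : U ≤ z.dom)
    {u : EuclideanSpace ℂ (Fin m)} (hu : u ∈ U.1) :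
    (z.restrict U h).extendLeft u = z.extendLeft u := by
  rw [extendLeft_apply, extend_restrict, extendLeft_apply]
  simp [Submodule.starProjection_eq_self_iff.2 hu]

end StiefelTotal

variable {k : ℕ}

/-- The chain of subspaces underlying a simplex. -/
def flag (s : (stiefelDiagram m V W).Simplex k) :
    Fin (k + 1) → Submodule ℂ (EuclideanSpace ℂ (Fin m)) := fun i => (s.1.1 i).1

/-- The isometry `G 0 ⊕ V → W` underlying a simplex with chain `G`. -/
def total (s : (stiefelDiagram m V W).Simplex k) : StiefelTotal m V W := s.1.2

theorem dom_total (s : (stiefelDiagram m V W).Simplex k) : (total s).dom.1 = flag s 0 :=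
  congrArg Subtype.val s.2.2

theorem flag_antitone (s : (stiefelDiagram m V W).Simplex k) : Antitone (flag s) :=
  fun _ _ h => s.2.1 h

theorem flag_ne_bot (s : (stiefelDiagram m V W).Simplex k) (i : Fin (k + 1)) : flag s i ≠ ⊥ :=
  (s.1.1 i).2

/-- The positive operator of norm one given by a point in a simplex. -/
def simplexOperator (s : (stiefelDiagram m V W).Simplex k) (p : stdSimplex ℝ (Fin (k + 1))) :
    EuclideanSpace ℂ (Fin m) →L[ℂ] EuclideanSpace ℂ (Fin m) :=
  flagSum (flag s) p

/-- The linear map `ℂᵐ → W` given by a point in a simplex, with absolute value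
`simplexOperator`. -/
def simplexMap (s : (stiefelDiagram m V W).Simplex k) (p : stdSimplex ℝ (Fin (k + 1))) :
    EuclideanSpace ℂ (Fin m) →L[ℂ] W :=
  (total s).extendLeft ∘L simplexOperator s p

theorem simplexMap_apply (s : (stiefelDiagram m V W).Simplex k)
    (p : stdSimplex ℝ (Fin (k + 1))) (u : EuclideanSpace ℂ (Fin m)) :
    simplexMap s p u = (total s).extendLeft (simplexOperator s p u) := rfl

theorem norm_simplexOperator (s : (stiefelDiagram m V W).Simplex k)
    (p : stdSimplex ℝ (Fin (k + 1))) : ‖simplexOperator s p‖ = 1 :=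
  (norm_flagSum (flag_antitone s) (flag_ne_bot s) p.2.1).trans p.2.2

/-- The operator takes values in `G 0`, where the isometry preserves norms. -/
theorem norm_simplexMap_apply (s : (stiefelDiagram m V W).Simplex k)
    (p : stdSimplex ℝ (Fin (k + 1))) (u : EuclideanSpace ℂ (Fin m)) :
    ‖simplexMap s p u‖ = ‖simplexOperator s p u‖ := by
  rw [simplexMap_apply, StiefelTotal.norm_extendLeft_apply, Submodule.starProjection_eq_self_iff.2]
  rw [dom_total]
  exact flagSum_mem (flag_antitone s) _ _

theorem norm_simplexMap (s : (stiefelDiagram m V W).Simplex k)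
    (p : stdSimplex ℝ (Fin (k + 1))) : ‖simplexMap s p‖ = 1 := by
  rw [← norm_simplexOperator s p]
  refine le_antisymm ?_ ?_ <;>
    refine ContinuousLinearMap.opNorm_le_bound _ (norm_nonneg _) fun u => ?_
  · rw [norm_simplexMap_apply]
    exact ContinuousLinearMap.le_opNorm _ _
  · rw [← norm_simplexMap_apply]
    exact ContinuousLinearMap.le_opNorm _ _

theorem toTensor_simplexMap_ne_zero (s : (stiefelDiagram m V W).Simplex k)
    (p : stdSimplex ℝ (Fin (k + 1))) : toTensor (simplexMap s p) ≠ 0 := by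
  rw [Ne, map_eq_zero_iff _ toTensor_injective, ← norm_eq_zero, norm_simplexMap]
  exact one_ne_zero

/-- The point of the sphere bundle given by a point in a simplex. -/
def simplexToSphere (s : (stiefelDiagram m V W).Simplex k) (p : stdSimplex ℝ (Fin (k + 1))) :
    SphereBundle m V W :=
  ⟨⟨((total s).restrictRight,
      -- The map has operator norm one, but the sphere bundle uses the tensor norm; hence the
      -- rescaling.
      ((‖toTensor (simplexMap s p)‖⁻¹ : ℝ) : ℂ) • toTensor (simplexMap s p)),
    Submodule.smul_mem _ _ (toTensor_mem_complementFibre _ fun _ =>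
      StiefelTotal.extendLeft_mem_orthogonal _ _)⟩, by
    rw [norm_smul, Complex.norm_real, norm_inv, norm_norm,
      inv_mul_cancel₀ (norm_ne_zero_iff.2 (toTensor_simplexMap_ne_zero s p))]⟩

theorem simplexToSphere_congr {l : ℕ} {s : (stiefelDiagram m V W).Simplex k}
    {s' : (stiefelDiagram m V W).Simplex l} {p : stdSimplex ℝ (Fin (k + 1))}
    {p' : stdSimplex ℝ (Fin (l + 1))} (h : (total s).restrictRight = (total s').restrictRight)
    (h' : simplexMap s p = simplexMap s' p') : simplexToSphere s p = simplexToSphere s' p' :=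
  Subtype.ext (Subtype.ext (Prod.ext h (by simp only [simplexToSphere, h'])))

/-- Each pushed-forward weight is the sum of `p` over a fibre of `θ`; regroup the sum by fibres. -/
theorem flagSum_map {E : Type*} [NormedAddCommGroup E] [InnerProductSpace ℂ E]
    [FiniteDimensional ℂ E] {l : ℕ} (G : Fin (l + 1) → Submodule ℂ E)
    (θ : Fin (k + 1) → Fin (l + 1)) (p : stdSimplex ℝ (Fin (k + 1))) :
    flagSum G (stdSimplex.map θ p) = flagSum (fun i => G (θ i)) p := by
  rw [flagSum, flagSum, ← Finset.sum_fiberwise Finset.univ θ]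
  refine Finset.sum_congr rfl fun j _ => ?_
  rw [stdSimplex.map_coe, FunOnFinite.linearMap_apply_apply, Complex.ofReal_sum, Finset.sum_smul]
  refine Finset.sum_congr rfl fun i hi => ?_
  obtain rfl := (Finset.mem_filter.1 hi).2
  rfl

theorem simplexToSphere_pull {l : ℕ} (θ : Fin (k + 1) →o Fin (l + 1))
    (s : (stiefelDiagram m V W).Simplex l) (p : stdSimplex ℝ (Fin (k + 1))) :
    simplexToSphere (s.pull θ) p = simplexToSphere s (stdSimplex.map θ p) := by
  refine simplexToSphere_congr (StiefelTotal.restrictRight_restrict _ _ _) ?_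
  ext1 u
  have hop : simplexOperator s (stdSimplex.map θ p) = simplexOperator (s.pull θ) p :=
    flagSum_map _ _ _
  rw [simplexMap_apply, simplexMap_apply, hop]
  exact StiefelTotal.extendLeft_restrict _ _ _ (flagSum_mem (flag_antitone (s.pull θ)) _ _)

variable (m V W) in
/-- The comparison map from the homotopy colimit to the sphere bundle. -/
def hocolimToSphere : StiefelHocolim m V W → SphereBundle m V W :=
  Quot.lift (fun x => simplexToSphere x.2.1 x.2.2) (by
    rintro _ _ ⟨θ, s, p⟩
    exact simplexToSphere_pull θ s p)

/-! ### Continuity of the comparison map -/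

theorem continuous_total :
    Continuous (total : (stiefelDiagram m V W).Simplex k → StiefelTotal m V W) := by
  have h : Continuous fun s : (stiefelDiagram m V W).Simplex k => s.1.2 :=
    continuous_snd.comp continuous_subtype_val
  exact h

theorem continuous_simplexOperator : Continuous
    fun x : (stiefelDiagram m V W).Simplex k × stdSimplex ℝ (Fin (k + 1)) =>
      simplexOperator x.1 x.2 := by
  have hp (i : Fin (k + 1)) : Continuous
      fun x : (stiefelDiagram m V W).Simplex k × stdSimplex ℝ (Fin (k + 1)) => x.2.1 i :=
    (continuous_apply i).comp (continuous_subtype_val.comp continuous_snd)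
  have hG (i : Fin (k + 1)) : Continuous
      fun x : (stiefelDiagram m V W).Simplex k × stdSimplex ℝ (Fin (k + 1)) => x.1.1.1 i :=
    (continuous_apply i).comp (continuous_fst.comp (continuous_subtype_val.comp continuous_fst))
  change Continuous
    fun x : (stiefelDiagram m V W).Simplex k × stdSimplex ℝ (Fin (k + 1)) =>
      ∑ i, ((x.2.1 i : ℝ) : ℂ) • (x.1.1.1 i).1.starProjection
  exact continuous_finsetSum _ fun i _ => (Complex.continuous_ofReal.comp (hp i)).smul
    (NonzeroSubspace.continuous_starProjection.comp (hG i))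

theorem continuous_simplexMap : Continuous
    fun x : (stiefelDiagram m V W).Simplex k × stdSimplex ℝ (Fin (k + 1)) =>
      simplexMap x.1 x.2 :=
  (StiefelTotal.continuous_extendLeft.comp (continuous_total.comp continuous_fst)).clm_comp
    continuous_simplexOperator

theorem continuous_hocolimToSphere [FiniteDimensional ℂ W] :
    Continuous (hocolimToSphere m V W) := by
  refine continuous_quot_lift _ (continuous_sigma fun k => ?_)
  refine Continuous.subtype_mk (Continuous.subtype_mk (Continuous.prodMk ?_ ?_) _) _
  · exact StiefelTotal.continuous_restrictRight.comp (continuous_total.comp continuous_fst)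
  · have h := (continuous_toTensor (W := W)).comp (continuous_simplexMap (m := m) (V := V) (k := k))
    exact (Complex.continuous_ofReal.comp
      (h.norm.inv₀ fun x => norm_ne_zero_iff.2 (toTensor_simplexMap_ne_zero _ _))).smul h

/-- On nondegenerate representatives, the tensor determines the map, the map its absolute value, and
the absolute value the flag and the weights. -/
theorem hocolimToSphere_injective : Function.Injective (hocolimToSphere m V W) := by
  intro x y hxy
  obtain ⟨k, s, p, rfl, hs, hp⟩ := TopDiagram.exists_nondegenerate x
  obtain ⟨l, t, q, rfl, ht, hq⟩ := TopDiagram.exists_nondegenerate y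
  change simplexToSphere s p = simplexToSphere t q at hxy
  have hprod := congrArg (fun a : SphereBundle m V W => a.1.1) hxy
  have hr : (total s).restrictRight = (total t).restrictRight := congrArg Prod.fst hprod
  have hx : ((‖toTensor (simplexMap s p)‖⁻¹ : ℝ) : ℂ) • toTensor (simplexMap s p) =
    ((‖toTensor (simplexMap t q)‖⁻¹ : ℝ) : ℂ) • toTensor (simplexMap t q) :=
    congrArg Prod.snd hprod
  rw [← map_smul, ← map_smul, toTensor_injective.eq_iff] at hx
  -- Both maps have operator norm one, so the two positive scaling factors agree.
  have hmap : simplexMap s p = simplexMap t q := by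
    have hn := congrArg norm hx
    rw [norm_smul, norm_smul, norm_simplexMap, norm_simplexMap, mul_one, mul_one,
      Complex.norm_real, Complex.norm_real, norm_inv, norm_inv, norm_norm, norm_norm] at hn
    rw [hn] at hx
    refine smul_right_injective _ ?_ hx
    exact Complex.ofReal_ne_zero.2 (inv_ne_zero
      (norm_ne_zero_iff.2 (toTensor_simplexMap_ne_zero t q)))
  have hop : simplexOperator s p = simplexOperator t q := by
    refine isPositive_ext_of_norm_apply_eq (flagSum_isPositive _ fun i => (hp i).le)
      (flagSum_isPositive _ fun i => (hq i).le) fun u => ?_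
    rw [← norm_simplexMap_apply, hmap, norm_simplexMap_apply]
  obtain ⟨e, h1, h2⟩ := flagSum_injective (fun _ _ h => hs h) (flag_ne_bot s) hp
    (fun _ _ h => ht h) (flag_ne_bot t) hq hop
  obtain rfl : k = l := Nat.succ_injective e
  have hpq : p = q := by
    ext i
    exact h2 i
  have hdom : (total s).dom = (total t).dom := Subtype.ext (by
    rw [dom_total, dom_total]
    exact h1 0)
  have hz : total s = total t := by
    refine StiefelTotal.ext_extend hdom (fun u hu => ?_) hr
    -- All weights are positive, so the operator maps onto `G 0`, and the map determines the
    -- isometry there.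
    rw [dom_total, ← range_flagSum (flag_antitone s) hp] at hu
    obtain ⟨w, rfl⟩ := hu
    have := congrArg (fun T => T w) hmap
    simp only [simplexMap_apply, ← hop] at this
    exact this
  have hst : s = t := Subtype.ext (Prod.ext (funext fun i => Subtype.ext (h1 i)) hz)
  rw [hpq, hst]

theorem hocolimToSphere_surjective [FiniteDimensional ℂ W] :
    Function.Surjective (hocolimToSphere m V W) := by
  rintro ⟨⟨⟨f, x⟩, hx⟩, hx1⟩
  change ‖x‖ = 1 at hx1
  obtain ⟨T, hT, rfl⟩ := exists_toTensor_eq hx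
  obtain ⟨A, S, hA, hSA, hS, hST⟩ := exists_polar_decomposition T
  obtain ⟨k, G, p, hG, hG0, hp, -, rfl⟩ := exists_eq_flagSum hA
  cases k with
  | zero =>
    -- The empty flag means that the absolute value is zero, impossible for a unit tensor.
    have hT0 : T = 0 := by
      ext1 u
      rw [← hSA]
      simp [flagSum]
    simp [hT0] at hx1
  | succ k =>
    simp only [range_flagSum hG.antitone hp] at hS
    -- This is the operator norm of `T`; dividing by it turns the weights into barycentric
    -- coordinates.
    set c := ∑ i, p i with hc
    have hc0 : 0 < c := Finset.sum_pos (fun i _ => hp i) Finset.univ_nonempty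
    let R : WithLp 2 (EuclideanSpace ℂ (Fin m) × V) →L[ℂ] W :=
      (S.coprod f.toContinuousLinearMap) ∘L (WithLp.prodContinuousLinearEquiv 2 ℂ
        (EuclideanSpace ℂ (Fin m)) V).toContinuousLinearMap
    have hR (u : EuclideanSpace ℂ (Fin m)) (v : V) : R (WithLp.toLp 2 (u, v)) = S u + f v := rfl
    obtain ⟨z, hz, hzR⟩ := StiefelTotal.exists_eq_extend ⟨G 0, hG0 0⟩ R fun u v => by
      rw [hR]
      -- `S` takes values in the range of `T`, which is orthogonal to `f(V)`; so `S` and `f`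
      -- together are isometric on `G 0 ⊕ V`.
      have horth : inner ℂ (S u) (f v) = 0 := by
        obtain ⟨w, hw⟩ := hST u
        rw [← hw]
        exact (Submodule.mem_orthogonal' _ _).1 (hT w) _ ⟨v, rfl⟩
      rw [← f.norm_map v, pow_two, pow_two, pow_two,
        norm_add_sq_eq_norm_sq_add_norm_sq_of_inner_eq_zero _ _ horth, hS]
    let s : (stiefelDiagram m V W).Simplex k :=
      ⟨(fun i => ⟨G i, hG0 i⟩, z), fun i j h => hG.antitone h, hz⟩
    let q : stdSimplex ℝ (Fin (k + 1)) := ⟨fun i => c⁻¹ * p i,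
      fun i => mul_nonneg (inv_nonneg.2 hc0.le) (hp i).le, by
        rw [← Finset.mul_sum, ← hc, inv_mul_cancel₀ hc0.ne']⟩
    refine ⟨Quot.mk _ ⟨k, (s, q)⟩, ?_⟩
    have hmap : simplexMap s q = ((c⁻¹ : ℝ) : ℂ) • T := by
      ext1 u
      have hop : simplexOperator s q u = ((c⁻¹ : ℝ) : ℂ) • flagSum G p u := by
        rw [flagSum_apply, Finset.smul_sum]
        refine (flagSum_apply _ _ _).trans (Finset.sum_congr rfl fun i _ => ?_)
        rw [smul_smul, ← Complex.ofReal_mul]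
        rfl
      rw [simplexMap_apply, hop, map_smul, smul_apply, ← hSA, StiefelTotal.extendLeft_apply]
      change _ • z.extend _ = _
      rw [hzR, hR, map_zero, add_zero]
    refine Subtype.ext (Subtype.ext (Prod.ext ?_ ?_))
    · ext v
      change z.extend (WithLp.toLp 2 (0, v)) = f v
      rw [hzR, hR, map_zero, zero_add]
    · change ((‖toTensor (simplexMap s q)‖⁻¹ : ℝ) : ℂ) • toTensor (simplexMap s q) = toTensor T
      rw [hmap, map_smul, norm_smul, hx1, mul_one, Complex.norm_real,
        Real.norm_of_nonneg (inv_nonneg.2 hc0.le), inv_inv, smul_smul, ← Complex.ofReal_mul,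
        mul_inv_cancel₀ hc0.ne', Complex.ofReal_one, one_smul]

instance : T2Space (SphereBundle m V W) := by
  have : T2Space (V →ₗᵢ[ℂ] W) := T2Space.of_injective_continuous
    LinearIsometry.toContinuousLinearMap_injective continuous_induced_dom
  exact inferInstanceAs (T2Space {y : ComplementBundle m V W // ‖y.1.2‖ = 1})

variable (m V W) in
/-- The sphere bundle is homeomorphic to the homotopy colimit. -/
def sphereHomeomorphHocolim [FiniteDimensional ℂ V] [FiniteDimensional ℂ W] :
    SphereBundle m V W ≃ₜ StiefelHocolim m V W :=
  -- A continuous bijection from a compact space to a Hausdorff space is a homeomorphism.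
  (Continuous.homeoOfEquivCompactToT2
    (f := Equiv.ofBijective (hocolimToSphere m V W)
      ⟨hocolimToSphere_injective, hocolimToSphere_surjective⟩)
    continuous_hocolimToSphere).symm

theorem sphereHomeomorphHocolim_symm_apply [FiniteDimensional ℂ V] [FiniteDimensional ℂ W]
    (x : StiefelHocolim m V W) :
    (sphereHomeomorphHocolim m V W).symm x = hocolimToSphere m V W x := rfl

/-! ### Equivariance -/

variable [RealStructure V] [RealStructure W]

theorem StiefelTotal.restrictRight_conj (z : StiefelTotal m V W) :
    z.conj.restrictRight = conjIsometry z.restrictRight := by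
  ext v
  rw [restrictRight_apply, extend_conj, conjIsometry_apply, restrictRight_apply]
  congr 2
  exact congrArg (fun a => WithLp.toLp 2 (a, _)) (map_zero _)

theorem StiefelTotal.extendLeft_conj (z : StiefelTotal m V W) (u : EuclideanSpace ℂ (Fin m)) :
    z.conj.extendLeft u =
      CalculusWithReality.conj (z.extendLeft (CalculusWithReality.conj u)) := by
  rw [extendLeft_apply, extend_conj, extendLeft_apply]
  congr 2
  exact congrArg (fun a => WithLp.toLp 2 (_, a)) (map_zero _)

theorem simplexOperator_conj (s : (stiefelDiagram m V W).Simplex k)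
    (p : stdSimplex ℝ (Fin (k + 1))) (u : EuclideanSpace ℂ (Fin m)) :
    simplexOperator ((stiefelInvolution m V W).onSimplex s) p u =
      conj (simplexOperator s p (conj u)) := by
  rw [simplexOperator, simplexOperator, flagSum_apply, flagSum_apply, map_sum]
  refine Finset.sum_congr rfl fun i _ => ?_
  rw [LinearIsometryEquiv.map_smulₛₗ, Complex.conj_ofReal]
  exact congrArg _ ((s.1.1 i).starProjection_conj u)

theorem simplexMap_conj (s : (stiefelDiagram m V W).Simplex k)
    (p : stdSimplex ℝ (Fin (k + 1))) (u : EuclideanSpace ℂ (Fin m)) :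
    simplexMap ((stiefelInvolution m V W).onSimplex s) p u = conj (simplexMap s p (conj u)) := by
  rw [simplexMap_apply, simplexOperator_conj]
  refine (StiefelTotal.extendLeft_conj (total s) _).trans ?_
  rw [conj_conj, simplexMap_apply]

/-- Every ingredient commutes with conjugation, and the scaling factor is real and unchanged because
conjugation preserves the tensor norm. -/
theorem hocolimToSphere_onHocolim (x : StiefelHocolim m V W) :
    hocolimToSphere m V W ((stiefelInvolution m V W).onHocolim x) =
      SphereBundle.conj m (hocolimToSphere m V W x) := by
  obtain ⟨⟨k, s, p⟩, rfl⟩ := Quot.exists_rep x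
  refine Subtype.ext (Subtype.ext (Prod.ext (StiefelTotal.restrictRight_conj (total s)) ?_))
  have h := toTensor_conj (simplexMap_conj s p)
  change ((‖toTensor (simplexMap ((stiefelInvolution m V W).onSimplex s) p)‖⁻¹ : ℝ) : ℂ) •
    toTensor (simplexMap ((stiefelInvolution m V W).onSimplex s) p) =
      conjTensor (((‖toTensor (simplexMap s p)‖⁻¹ : ℝ) : ℂ) • toTensor (simplexMap s p))
  rw [h, norm_conjTensor, LinearMap.map_smulₛₗ, Complex.conj_ofReal]

theorem hocolimToSphere_smul (g : C₂) (x : StiefelHocolim m V W) :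
    hocolimToSphere m V W (g • x) = g • hocolimToSphere m V W x := by
  change hocolimToSphere m V W (if g = 1 then x else (stiefelInvolution m V W).onHocolim x) =
    if g = 1 then hocolimToSphere m V W x else SphereBundle.conj m (hocolimToSphere m V W x)
  split_ifs
  · rfl
  · exact hocolimToSphere_onHocolim x

end Comparison

end CalculusWithReality

end

theorem mainTheorem5 (n : ℕ)
    {V : Type*} [NormedAddCommGroup V] [InnerProductSpace ℂ V] [FiniteDimensional ℂ V]
    [CalculusWithReality.RealStructure V]
    {W : Type*} [NormedAddCommGroup W] [InnerProductSpace ℂ W] [FiniteDimensional ℂ W]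
    [CalculusWithReality.RealStructure W] :
    ∃ e : CalculusWithReality.SphereBundle (n + 1) V W ≃ₜ
        CalculusWithReality.StiefelHocolim (n + 1) V W,
      ∀ (g : CalculusWithReality.C₂) (y : CalculusWithReality.SphereBundle (n + 1) V W),
        e (g • y) = g • e y := by
  refine ⟨CalculusWithReality.sphereHomeomorphHocolim (n + 1) V W, fun g y => ?_⟩
  -- Equivariance is known for the explicit inverse and is transferred to the homeomorphism.
  rw [← Homeomorph.eq_symm_apply, CalculusWithReality.sphereHomeomorphHocolim_symm_apply,
    CalculusWithReality.hocolimToSphere_smul,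
    ← CalculusWithReality.sphereHomeomorphHocolim_symm_apply, Homeomorph.symm_apply_apply]
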